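/- Let $0<\alpha<\beta<L$, let $\tau,\kappa_1,\kappa_2,\kappa_3>0$, and let $\delta_1,\delta_2,\delta_3\in\mathbb R$ satisfy hypothesis (H): $$\kappa_3>0,\quad \delta_1>0,\quad \delta_3>0,\quad \delta_2\neq 0,\quad \delta_3>\frac1{2\kappa_3},\quad |\delta_2|<\frac1{\kappa_3}\sqrt{2\kappa_3\delta_3-1}.$$ All functions are complex valued. Let $\mathbb L^2=L^2(0,\alpha)\times L^2(\alpha,\beta)\times L^2(\beta,L)$ and $$\mathbb H^1_L=\{(u,v,w)\in H^1(0,\alpha)\times H^1(\alpha,\beta)\times H^1(\beta,L):\ u(0)=0,\ u(\alpha)=v(\alpha),\ v(\beta)=w(\beta)\}.$$ Let $\mathcal H=\mathbb H^1_L\times\mathbb L^2\times L^2(0,1)$ be the energy space, with elements $U=(u,v,w,y,z,\phi,\eta)$ and inner product $$\langle U,\tilde U\rangle=\kappa_1\!\int_0^\alpha u_x\overline{\tilde u_x}\,dx+\kappa_2\!\int_\alpha^\beta v_x\overline{\tilde v_x}\,dx+\kappa_3\!\int_\beta^L w_x\overline{\tilde w_x}\,dx+\int_0^\alpha y\overline{\tilde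 y}\,dx+\int_\alpha^\beta z\overline{\tilde z}\,dx+\int_\beta^L\phi\overline{\tilde\phi}\,dx+\tau\int_0^1\eta\overline{\tilde\eta}\,d\rho .$$ Let $\mathcal A$ be the operator in $\mathcal H$ whose domain $D(\mathcal A)$ consists of all $(u,v,w,y,z,\phi,\eta)\in\mathbb H^1_L\times\mathbb H^1_L\times H^1(0,1)$ such that $u\in H^2(0,\alpha)$, $\kappa_2v+\delta_1z\in H^2(\alpha,\beta)$, $w\in H^2(\beta,L)$, $$(\kappa_2v+\delta_1z)_x(\alpha)=\kappa_1u_x(\alpha),\quad(\kappa_2v+\delta_1z)_x(\beta)=\kappa_3w_x(\beta),\quad w_x(L)=-\delta_3\eta(0)-\delta_2\eta(1),\quad \phi(L)=\eta(0),$$ and which is given by $$\mathcal A(u,v,w,y,z,\phi,\eta)=\bigl(y,z,\phi,\kappa_1u_{xx},(\kappa_2v+\delta_1z)_{xx},\kappa_3w_{xx},-\tau^{-1}\eta_\rho\bigr).$$ Then $\mathcal A$ is m-dissipative in $\mathcal H$, that is, $\operatorname{Re}\langle\mathcal AU,U\rangle\le 0$ for all $U\in D(\mathcal A)$, and $\lambda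 I-\mathcal A$ maps $D(\mathcal A)$ onto $\mathcal H$ for every $\lambda>0$. Moreover, $\mathcal A$ is the infinitesimal generator of a $C_0$-semigroup of contractions $(e^{t\mathcal A})_{t\ge0}$ on $\mathcal H$. For every $U_0\in\mathcal H$ the problem $U'=\mathcal AU$, $U(0)=U_0$, has exactly one weak solution $U\in C([0,\infty),\mathcal H)$, and $U(t)=e^{t\mathcal A}U_0$. Here $U\in C([0,\infty),\mathcal H)$ is a weak solution if $U(0)=U_0$ and, for every $\psi\in D(\mathcal A^*)$, the function $t\mapsto\langle U(t),\psi\rangle$ is locally absolutely continuous on $[0,\infty)$ with derivative $\langle U(t),\mathcal A^*\psi\rangle$ for almost every $t$. If $U_0\in D(\mathcal A)$, then $U\in C^1([0,\infty),\mathcal H)\cap C([0,\infty),D(\mathcal A))$, where $D(\mathcal A)$ carries the graph norm, and $U'(t)=\mathcal AU(t)$ for all $t\ge0$. -/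

import Mathlib

open scoped NNReal

namespace BoundaryDelay

noncomputable section

open MeasureTheory Set Filter Topology
open scoped ContDiff

/-! ### Operators and semigroups on a Hilbert space -/

section Abstract

variable {E : Type*} [NormedAddCommGroup E] [InnerProductSpace ℂ E]

/-- `A` is dissipative: `Re ⟨A x, x⟩ ≤ 0` for every `x ∈ D(A)`. -/
def IsDissipative (A : E →ₗ.[ℂ] E) : Prop :=
  ∀ x : A.domain, (inner ℂ (A x) (x : E)).re ≤ 0

/-- `A` is m-dissipative: it is dissipative and `λ I - A` maps `D(A)` onto `E` for
every `λ > 0`. -/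
def IsMDissipative (A : E →ₗ.[ℂ] E) : Prop :=
  IsDissipative A ∧
    ∀ r : ℝ, 0 < r → ∀ f : E, ∃ x : A.domain, (r : ℂ) • (x : E) - A x = f

/-- `(T t)_{t ≥ 0}` is a `C₀`-semigroup of contractions on `E`. -/
structure IsContractionSemigroup (T : ℝ≥0 → E →L[ℂ] E) : Prop where
  map_zero : T 0 = ContinuousLinearMap.id ℂ E
  map_add : ∀ s t : ℝ≥0, T (s + t) = (T s).comp (T t)
  strongly_continuous : ∀ x : E, Continuous fun t : ℝ≥0 => T t x
  norm_le_one : ∀ t : ℝ≥0, ‖T t‖ ≤ 1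

/-- `A` is the infinitesimal generator of `(T t)_{t ≥ 0}`: one has `x ∈ D(A)` and `A x = y` if and
only if `(T t x - x) / t → y` as `t → 0⁺`. -/
def IsGenerator (A : E →ₗ.[ℂ] E) (T : ℝ≥0 → E →L[ℂ] E) : Prop :=
  ∀ x y : E, (∃ hx : x ∈ A.domain, A ⟨x, hx⟩ = y) ↔
    Tendsto (fun t : ℝ≥0 => (t : ℝ)⁻¹ • (T t x - x)) (𝓝[>] 0) (𝓝 y)

/-- `U ∈ C([0, ∞), E)` is a weak solution of `U' = A U`, `U(0) = x₀`: for every `ψ` in the domain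
of the adjoint `A*`, the function `t ↦ ⟨U(t), ψ⟩` is absolutely continuous with derivative
`⟨U(t), A* ψ⟩`, which is written here in integrated form. The pairs `(ψ, ψ')` below are those with
`ψ ∈ D(A*)` and `ψ' = A* ψ`. Mathlib's inner product is conjugate linear in its first argument. -/
def IsWeakSolution (A : E →ₗ.[ℂ] E) (x₀ : E) (U : C(ℝ≥0, E)) : Prop :=
  U 0 = x₀ ∧
    ∀ ψ ψ' : E, (∀ x : A.domain, inner ℂ ψ (A x) = inner ℂ ψ' (x : E)) →
      ∀ t : ℝ≥0, inner ℂ ψ (U t) =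
        inner ℂ ψ x₀ + ∫ s in (0 : ℝ)..t, inner ℂ ψ' (U s.toNNReal)

/-- `U ∈ C¹([0, ∞), E) ∩ C([0, ∞), D(A))`, where `D(A)` carries the graph norm, and `U' = A U`
on `[0, ∞)`, `U(0) = x₀`. -/
def IsStrongSolution (A : E →ₗ.[ℂ] E) (x₀ : E) (U : C(ℝ≥0, E)) : Prop :=
  U 0 = x₀ ∧ ContDiffOn ℝ 1 (fun t : ℝ => U t.toNNReal) (Ici 0) ∧
    ∃ hU : ∀ t, U t ∈ A.domain,
      (Continuous fun t : ℝ≥0 => (U t, A ⟨U t, hU t⟩)) ∧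
      ∀ t : ℝ≥0, HasDerivWithinAt (fun s : ℝ => U s.toNNReal) (A ⟨U t, hU t⟩) (Ici 0) t

end Abstract

/-! ### Test functions and weak derivatives on an interval -/

/-- `φ ∈ C_c^∞(a, b)`, real valued. -/
def IsTestFunction (a b : ℝ) (φ : ℝ → ℝ) : Prop :=
  ContDiff ℝ ∞ φ ∧ HasCompactSupport φ ∧ tsupport φ ⊆ Ioo a b

theorem integrable_smul_test {a b : ℝ} {φ : ℝ → ℝ} (hφ : Continuous φ)
    (hc : HasCompactSupport φ) {f : ℝ → ℂ} (hf : Integrable f (volume.restrict (Ioo a b))) :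
    Integrable (fun x => φ x • f x) (volume.restrict (Ioo a b)) :=
  hf.locallyIntegrable.integrable_smul_left_of_hasCompactSupport hφ hc

theorem IsTestFunction.deriv_continuous {a b : ℝ} {φ : ℝ → ℝ} (h : IsTestFunction a b φ) :
    Continuous (deriv φ) := h.1.continuous_deriv (by simp)

theorem exists_test_integral_one {a b : ℝ} (hab : a < b) :
    ∃ ψ, IsTestFunction a b ψ ∧ ∫ x, ψ x = 1 := by
  let B : ContDiffBump ((a + b) / 2) := ⟨(b - a) / 8, (b - a) / 4, by linarith, by linarith⟩
  refine ⟨B.normed volume, ⟨B.contDiff_normed, B.hasCompactSupport_normed, ?_⟩,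
    B.integral_normed⟩
  rw [B.tsupport_normed_eq, Real.closedBall_eq_Icc]
  intro x hx
  simp only [B, mem_Icc, mem_Ioo] at hx ⊢
  constructor <;> linarith [hx.1, hx.2]

/-- A test function with integral zero is the derivative of a test function. -/
theorem exists_test_primitive {a b : ℝ} {χ : ℝ → ℝ} (hχ : IsTestFunction a b χ)
    (h0 : ∫ x, χ x = 0) : ∃ Φ, IsTestFunction a b Φ ∧ deriv Φ = χ := by
  obtain ⟨h1, h2, h3⟩ := hχ
  by_cases hne : (tsupport χ).Nonempty
  swap
  · rw [not_nonempty_iff_eq_empty, tsupport_eq_empty_iff] at hne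
    subst hne
    refine ⟨0, ⟨contDiff_const, HasCompactSupport.zero, by simp [tsupport]⟩, ?_⟩
    ext x; simp
  have hcpt : IsCompact (tsupport χ) := h2
  set p := sInf (tsupport χ) with hp
  set q := sSup (tsupport χ) with hq
  have hpm : p ∈ tsupport χ := hcpt.sInf_mem hne
  have hqm : q ∈ tsupport χ := hcpt.sSup_mem hne
  have hzero : ∀ x, x ∉ Icc p q → χ x = 0 := by
    intro x hx
    by_contra hcon
    exact hx ⟨csInf_le hcpt.bddBelow (subset_tsupport _ hcon),
      le_csSup hcpt.bddAbove (subset_tsupport _ hcon)⟩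
  have hcont : Continuous χ := h1.continuous
  let Φ : ℝ → ℝ := fun x => ∫ t in p..x, χ t
  have hder : ∀ x, HasDerivAt Φ (χ x) x := fun x =>
    (hcont.integral_hasStrictDerivAt p x).hasDerivAt
  have hd : deriv Φ = χ := funext fun x => (hder x).deriv
  have hsupp : ∀ x, x ∉ Icc p q → Φ x = 0 := by
    intro x hx
    rcases lt_or_ge x p with hxp | hxp
    · simp only [Φ]
      rw [intervalIntegral.integral_symm, intervalIntegral.integral_zero_ae, neg_zero]
      have : ∀ᵐ t : ℝ, t ≠ p := by simp [ae_iff]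
      filter_upwards [this] with t ht ht2
      rw [uIoc_of_le hxp.le] at ht2
      exact hzero t fun h => ht (le_antisymm ht2.2 h.1)
    · have hxq : q < x := by
        by_contra hcon
        exact hx ⟨hxp, not_lt.mp hcon⟩
      simp only [Φ]
      rw [intervalIntegral.integral_of_le hxp, ← integral_Icc_eq_integral_Ioc,
        setIntegral_eq_integral_of_forall_compl_eq_zero, h0]
      intro t ht
      exact hzero t fun h => ht ⟨h.1, h.2.trans hxq.le⟩
  have hts : tsupport Φ ⊆ Icc p q :=
    closure_minimal (fun x hx => by by_contra hcon; exact hx (hsupp x hcon)) isClosed_Icc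
  refine ⟨Φ, ⟨?_, ?_, ?_⟩, hd⟩
  · rw [contDiff_infty_iff_deriv, hd]
    exact ⟨fun x => (hder x).differentiableAt, h1⟩
  · exact isCompact_Icc.of_isClosed_subset (isClosed_tsupport _) hts
  · exact hts.trans fun x hx => ⟨(h3 hpm).1.trans_le hx.1, hx.2.trans_lt (h3 hqm).2⟩

theorem setIntegral_test {a b : ℝ} {φ : ℝ → ℝ} (h : tsupport φ ⊆ Ioo a b) :
    ∫ x in Ioo a b, φ x = ∫ x, φ x :=
  setIntegral_eq_integral_of_forall_compl_eq_zero fun x hx => by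
    by_contra hcon
    exact hx (h (subset_tsupport _ hcon))

theorem ae_eq_zero_of_test {a b : ℝ} {f : ℝ → ℂ}
    (hf : Integrable f (volume.restrict (Ioo a b)))
    (h : ∀ φ, IsTestFunction a b φ → ∫ x in Ioo a b, φ x • f x = 0) :
    ∀ᵐ x ∂(volume.restrict (Ioo a b)), f x = 0 := by
  rw [ae_restrict_iff' measurableSet_Ioo]
  refine isOpen_Ioo.ae_eq_zero_of_integral_contDiff_smul_eq_zero
    (IntegrableOn.locallyIntegrableOn hf) fun φ h1 h2 h3 => ?_
  rw [← h φ ⟨h1, h2, h3⟩, setIntegral_eq_integral_of_forall_compl_eq_zero]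
  intro x hx
  have : φ x = 0 := by
    by_contra hcon
    exact hx (h3 (subset_tsupport _ hcon))
  simp [this]

/-- A function with weak derivative zero is a.e. constant. -/
theorem ae_const_of_weakDeriv_zero {a b : ℝ} (hab : a < b) {f : ℝ → ℂ}
    (hf : Integrable f (volume.restrict (Ioo a b)))
    (h : ∀ φ, IsTestFunction a b φ → ∫ x in Ioo a b, deriv φ x • f x = 0) :
    ∃ c : ℂ, ∀ᵐ x ∂(volume.restrict (Ioo a b)), f x = c := by
  obtain ⟨ψ, hψ, hψ1⟩ := exists_test_integral_one hab
  set c : ℂ := ∫ x in Ioo a b, ψ x • f x with hc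
  refine ⟨c, ?_⟩
  have hz := ae_eq_zero_of_test (a := a) (b := b) (f := fun x => f x - c)
    (hf.sub (integrable_const c)) ?_
  · filter_upwards [hz] with x hx using sub_eq_zero.mp hx
  intro φ hφ
  set m : ℝ := ∫ x, φ x with hm
  have hiφ : Integrable φ := hφ.1.continuous.integrable_of_hasCompactSupport hφ.2.1
  have hiψ : Integrable ψ := hψ.1.continuous.integrable_of_hasCompactSupport hψ.2.1
  obtain ⟨Φ, hΦ, hΦ'⟩ := exists_test_primitive (a := a) (b := b) (χ := fun x => φ x - m * ψ x)
    ⟨hφ.1.sub (contDiff_const.mul hψ.1), hφ.2.1.sub hψ.2.1.mul_left,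
      (tsupport_sub _ _).trans (union_subset hφ.2.2
        ((tsupport_mul_subset_right).trans hψ.2.2))⟩
    (by rw [integral_sub hiφ (hiψ.const_mul m), integral_const_mul, hψ1]; simp [hm])
  have key := h Φ hΦ
  rw [hΦ'] at key
  have hφf := integrable_smul_test (a := a) (b := b) hφ.1.continuous hφ.2.1 hf
  have hψf := integrable_smul_test (a := a) (b := b) hψ.1.continuous hψ.2.1 hf
  have e1 : ∀ x, (φ x - m * ψ x) • f x = φ x • f x - m • (ψ x • f x) := by
    intro x; rw [sub_smul, mul_smul]
  simp_rw [e1] at key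
  rw [integral_sub (g := fun x => m • (ψ x • f x)) hφf (hψf.smul m), integral_smul, ← hc] at key
  simp_rw [smul_sub]
  rw [integral_sub hφf (integrable_smul_test hφ.1.continuous hφ.2.1 (integrable_const c)),
    integral_smul_const, setIntegral_test hφ.2.2]
  exact key

/-- The primitive of an integrable function `g` has weak derivative `g`. -/
theorem weakDeriv_primitive {a b : ℝ} {g : ℝ → ℂ}
    (hg : Integrable g (volume.restrict (Ioo a b))) {φ : ℝ → ℝ} (hφ : IsTestFunction a b φ) :
    ∫ x in Ioo a b, deriv φ x • (∫ t in a..x, g t) = - ∫ x in Ioo a b, φ x • g x := by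
  have hb : φ b = 0 := by
    by_contra hcon
    exact lt_irrefl _ (hφ.2.2 (subset_tsupport _ hcon)).2
  have hdc : HasCompactSupport (deriv φ) := hφ.2.1.deriv
  have hdi : Integrable (deriv φ) (volume.restrict (Ioo a b)) :=
    (hφ.deriv_continuous.integrable_of_hasCompactSupport hdc).restrict
  have hprod := hdi.smul_prod hg
  have hms : MeasurableSet {p : ℝ × ℝ | p.2 < p.1} := measurableSet_lt measurable_snd measurable_fst
  have hind := hprod.indicator hms
  have hswap := integral_integral_swap
    (f := fun x t => ({p : ℝ × ℝ | p.2 < p.1}).indicator (fun z => deriv φ z.1 • g z.2) (x, t)) hind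
  have hL : ∀ x ∈ Ioo a b, ∫ t in Ioo a b,
      ({p : ℝ × ℝ | p.2 < p.1}).indicator (fun z => deriv φ z.1 • g z.2) (x, t)
      = deriv φ x • (∫ t in a..x, g t) := by
    intro x hx
    have : ∀ t, ({p : ℝ × ℝ | p.2 < p.1}).indicator (fun z => deriv φ z.1 • g z.2) (x, t)
        = (Iio x).indicator (fun t => deriv φ x • g t) t := by
      intro t; simp [indicator]
    simp_rw [this]
    rw [setIntegral_indicator measurableSet_Iio, integral_smul, intervalIntegral.integral_of_le hx.1.le,
      integral_Ioc_eq_integral_Ioo]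
    congr 3
    ext t; simp only [mem_inter_iff, mem_Ioo, mem_Iio]
    exact ⟨fun h => ⟨h.1.1, h.2⟩, fun h => ⟨⟨h.1, h.2.trans hx.2⟩, h.2⟩⟩
  have hR : ∀ t ∈ Ioo a b, ∫ x in Ioo a b,
      ({p : ℝ × ℝ | p.2 < p.1}).indicator (fun z => deriv φ z.1 • g z.2) (x, t)
      = - (φ t • g t) := by
    intro t ht
    have : ∀ x, ({p : ℝ × ℝ | p.2 < p.1}).indicator (fun z => deriv φ z.1 • g z.2) (x, t)
        = (Ioi t).indicator (fun x => deriv φ x • g t) x := by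
      intro x; simp [indicator]
    simp_rw [this]
    rw [setIntegral_indicator measurableSet_Ioi, integral_smul_const]
    have hs : Ioo a b ∩ Ioi t = Ioo t b := by
      ext x; simp only [mem_inter_iff, mem_Ioo, mem_Ioi]
      exact ⟨fun h => ⟨h.2, h.1.2⟩, fun h => ⟨⟨ht.1.trans h.1, h.2⟩, h.1⟩⟩
    rw [hs, ← integral_Ioc_eq_integral_Ioo, ← intervalIntegral.integral_of_le ht.2.le,
      intervalIntegral.integral_deriv_eq_sub (fun x _ => hφ.1.differentiable (by simp) x)
        (hφ.deriv_continuous.intervalIntegrable _ _), hb]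
    simp
  rw [setIntegral_congr_fun measurableSet_Ioo hL, setIntegral_congr_fun measurableSet_Ioo hR,
    integral_neg] at hswap
  exact hswap

/-- A function with an integrable weak derivative on `(a, b)` has a representative that is
continuous on `[a, b]`. -/
theorem exists_continuous_rep {a b : ℝ} (hab : a < b) {f g : ℝ → ℂ}
    (hf : Integrable f (volume.restrict (Ioo a b))) (hg : Integrable g (volume.restrict (Ioo a b)))
    (h : ∀ φ, IsTestFunction a b φ →
      ∫ x in Ioo a b, deriv φ x • f x = - ∫ x in Ioo a b, φ x • g x) :
    ∃ F : ℝ → ℂ, ContinuousOn F (Icc a b) ∧ f =ᵐ[volume.restrict (Ioo a b)] F := by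
  have hgI : IntegrableOn g (Icc a b) := by
    rw [integrableOn_Icc_iff_integrableOn_Ioo]; exact hg
  have hGc : ContinuousOn (fun x => ∫ t in a..x, g t) (Icc a b) :=
    intervalIntegral.continuousOn_primitive_interval (by rwa [uIcc_of_le hab.le]) |>.mono
      (by rw [uIcc_of_le hab.le])
  have hGi : Integrable (fun x => ∫ t in a..x, g t) (volume.restrict (Ioo a b)) :=
    (hGc.integrableOn_Icc).mono_set Ioo_subset_Icc_self
  obtain ⟨c, hc⟩ := ae_const_of_weakDeriv_zero hab (f := fun x => f x - ∫ t in a..x, g t)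
    (hf.sub hGi) (by
      intro φ hφ
      simp_rw [smul_sub]
      rw [integral_sub (integrable_smul_test hφ.deriv_continuous hφ.2.1.deriv hf)
        (integrable_smul_test hφ.deriv_continuous hφ.2.1.deriv hGi), h φ hφ,
        weakDeriv_primitive hg hφ, sub_self])
  refine ⟨fun x => c + ∫ t in a..x, g t, continuousOn_const.add hGc, ?_⟩
  filter_upwards [hc] with x hx
  rw [← hx]; ring

/-! ### The spaces `L²(a, b)`, `H¹(a, b)`, `H²(a, b)` and boundary values -/

/-- The space `L²(a, b)` of complex-valued functions, modulo a.e. equality. -/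
abbrev L2 (a b : ℝ) : Type := Lp ℂ 2 (volume.restrict (Ioo a b))

variable {a b : ℝ}

theorem L2.integrable (f : L2 a b) : Integrable f (volume.restrict (Ioo a b)) :=
  (Lp.memLp f).integrable (by norm_num)

/-- `g` is the weak derivative of `f` on `(a, b)`. -/
def HasWeakDeriv (f g : L2 a b) : Prop :=
  ∀ φ : ℝ → ℝ, IsTestFunction a b φ →
    ∫ x in Ioo a b, deriv φ x • f x = - ∫ x in Ioo a b, φ x • g x

theorem integral_smul_add {φ : ℝ → ℝ} (h1 : Continuous φ) (h2 : HasCompactSupport φ)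
    (f g : L2 a b) : ∫ x in Ioo a b, φ x • (f + g) x
      = (∫ x in Ioo a b, φ x • f x) + ∫ x in Ioo a b, φ x • g x := by
  rw [← integral_add (integrable_smul_test h1 h2 f.integrable)
    (integrable_smul_test h1 h2 g.integrable)]
  refine integral_congr_ae ?_
  filter_upwards [Lp.coeFn_add f g] with x hx
  rw [hx, Pi.add_apply, smul_add]

theorem integral_smul_smul (φ : ℝ → ℝ) (c : ℂ) (f : L2 a b) :
    ∫ x in Ioo a b, φ x • (c • f) x = c * ∫ x in Ioo a b, φ x • f x := by
  rw [← integral_const_mul]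
  refine integral_congr_ae ?_
  filter_upwards [Lp.coeFn_smul c f] with x hx
  rw [hx, Pi.smul_apply, smul_comm, smul_eq_mul]

theorem HasWeakDeriv.add {f g f' g' : L2 a b} (h : HasWeakDeriv f f') (k : HasWeakDeriv g g') :
    HasWeakDeriv (f + g) (f' + g') := by
  intro φ hφ
  rw [integral_smul_add hφ.deriv_continuous hφ.2.1.deriv,
    integral_smul_add hφ.1.continuous hφ.2.1, h φ hφ, k φ hφ, neg_add]

theorem HasWeakDeriv.smul (c : ℂ) {f f' : L2 a b} (h : HasWeakDeriv f f') :
    HasWeakDeriv (c • f) (c • f') := by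
  intro φ hφ
  rw [integral_smul_smul, integral_smul_smul, h φ hφ, mul_neg]

theorem HasWeakDeriv.zero : HasWeakDeriv (0 : L2 a b) 0 := by
  have := integral_smul_smul (a := a) (b := b) (c := 0) (f := 0)
  simp only [smul_zero, zero_mul] at this
  intro φ _
  rw [this, this, neg_zero]

theorem HasWeakDeriv.unique {f g g' : L2 a b} (h : HasWeakDeriv f g) (k : HasWeakDeriv f g') :
    g = g' := by
  have hz := ae_eq_zero_of_test (a := a) (b := b) (f := fun x => g x - g' x)
    (g.integrable.sub g'.integrable) (by
      intro φ hφ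
      simp_rw [smul_sub]
      rw [integral_sub (integrable_smul_test hφ.1.continuous hφ.2.1 g.integrable)
        (integrable_smul_test hφ.1.continuous hφ.2.1 g'.integrable),
        ← neg_inj, neg_sub, neg_zero, sub_eq_zero, ← neg_inj, ← h φ hφ, ← k φ hφ])
  refine Lp.ext ?_
  filter_upwards [hz] with x hx using sub_eq_zero.mp hx

/-- The Sobolev space `H¹(a, b)`. -/
def H1 (a b : ℝ) : Submodule ℂ (L2 a b) where
  carrier := {f | ∃ g, HasWeakDeriv f g}
  add_mem' := fun ⟨f', hf⟩ ⟨g', hg⟩ => ⟨f' + g', hf.add hg⟩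
  zero_mem' := ⟨0, HasWeakDeriv.zero⟩
  smul_mem' := fun c _ ⟨f', hf⟩ => ⟨c • f', hf.smul c⟩

open Classical in
/-- The weak derivative of `f ∈ H¹(a, b)` (and `0` for `f ∉ H¹(a, b)`). -/
def wderiv (f : L2 a b) : L2 a b :=
  if h : ∃ g, HasWeakDeriv f g then h.choose else 0

theorem hasWeakDeriv_wderiv {f : L2 a b} (hf : f ∈ H1 a b) : HasWeakDeriv f (wderiv f) := by
  have h : ∃ g, HasWeakDeriv f g := hf
  rw [wderiv, dif_pos h]
  exact h.choose_spec

theorem HasWeakDeriv.wderiv_eq {f g : L2 a b} (h : HasWeakDeriv f g) : wderiv f = g :=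
  (hasWeakDeriv_wderiv ⟨g, h⟩).unique h

theorem wderiv_add {f g : L2 a b} (hf : f ∈ H1 a b) (hg : g ∈ H1 a b) :
    wderiv (f + g) = wderiv f + wderiv g :=
  ((hasWeakDeriv_wderiv hf).add (hasWeakDeriv_wderiv hg)).wderiv_eq

theorem wderiv_smul (c : ℂ) {f : L2 a b} (hf : f ∈ H1 a b) :
    wderiv (c • f) = c • wderiv f :=
  ((hasWeakDeriv_wderiv hf).smul c).wderiv_eq

theorem wderiv_zero : wderiv (0 : L2 a b) = 0 := HasWeakDeriv.zero.wderiv_eq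

/-- The Sobolev space `H²(a, b)`. -/
def H2 (a b : ℝ) : Submodule ℂ (L2 a b) where
  carrier := {f | f ∈ H1 a b ∧ wderiv f ∈ H1 a b}
  add_mem' := fun {f g} hf hg => ⟨add_mem hf.1 hg.1, by
    rw [wderiv_add hf.1 hg.1]; exact add_mem hf.2 hg.2⟩
  zero_mem' := ⟨zero_mem _, by rw [wderiv_zero]; exact zero_mem _⟩
  smul_mem' := fun c f hf => ⟨Submodule.smul_mem _ c hf.1, by
    rw [wderiv_smul c hf.1]; exact Submodule.smul_mem _ c hf.2⟩

/-- `F` is a continuous representative on `[a, b]` of the class `f ∈ L²(a, b)`. -/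
def IsContRep (f : L2 a b) (F : ℝ → ℂ) : Prop :=
  ContinuousOn F (Icc a b) ∧ f =ᵐ[volume.restrict (Ioo a b)] F

open Classical in
/-- The value at `x ∈ [a, b]` of the continuous representative of `f ∈ H¹(a, b)`
(and `0` where no continuous representative exists). -/
def trace (f : L2 a b) (x : ℝ) : ℂ :=
  if h : ∃ F, IsContRep f F then h.choose x else 0

theorem exists_isContRep (hab : a < b) {f : L2 a b} (hf : f ∈ H1 a b) : ∃ F, IsContRep f F :=
  have ⟨g, hg⟩ := hf
  exists_continuous_rep hab f.integrable g.integrable hg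

theorem IsContRep.trace_eq (hab : a < b) {f : L2 a b} {F : ℝ → ℂ} (h : IsContRep f F) {x : ℝ}
    (hx : x ∈ Icc a b) : trace f x = F x := by
  have hex : ∃ F, IsContRep f F := ⟨F, h⟩
  rw [trace, dif_pos hex]
  refine Measure.eqOn_Icc_of_ae_eq volume hab.ne ?_ hex.choose_spec.1 h.1 hx
  rw [← restrict_Ioo_eq_restrict_Icc]
  exact hex.choose_spec.2.symm.trans h.2

theorem trace_add (hab : a < b) {f g : L2 a b} (hf : f ∈ H1 a b) (hg : g ∈ H1 a b) {x : ℝ}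
    (hx : x ∈ Icc a b) : trace (f + g) x = trace f x + trace g x := by
  obtain ⟨F, hF⟩ := exists_isContRep hab hf
  obtain ⟨G, hG⟩ := exists_isContRep hab hg
  have : IsContRep (f + g) (F + G) := ⟨hF.1.add hG.1, (Lp.coeFn_add f g).trans (hF.2.add hG.2)⟩
  rw [this.trace_eq hab hx, hF.trace_eq hab hx, hG.trace_eq hab hx, Pi.add_apply]

theorem trace_smul (hab : a < b) (c : ℂ) {f : L2 a b} (hf : f ∈ H1 a b) {x : ℝ}
    (hx : x ∈ Icc a b) : trace (c • f) x = c * trace f x := by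
  obtain ⟨F, hF⟩ := exists_isContRep hab hf
  have : IsContRep (c • f) (c • F) :=
    ⟨hF.1.const_smul c, (Lp.coeFn_smul c f).trans (hF.2.const_smul c)⟩
  rw [this.trace_eq hab hx, hF.trace_eq hab hx, Pi.smul_apply, smul_eq_mul]

theorem trace_zero (hab : a < b) {x : ℝ} (hx : x ∈ Icc a b) : trace (0 : L2 a b) x = 0 :=
  IsContRep.trace_eq hab (F := 0) ⟨continuousOn_const, Lp.coeFn_zero ..⟩ hx

theorem eq_zero_of_wderiv_eq_zero (hab : a < b) {f : L2 a b} (hf : f ∈ H1 a b)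
    (h : wderiv f = 0) {x : ℝ} (hx : x ∈ Icc a b) (h0 : trace f x = 0) : f = 0 := by
  have hw := hasWeakDeriv_wderiv hf
  obtain ⟨c, hc⟩ := ae_const_of_weakDeriv_zero hab f.integrable (by
    intro φ hφ
    have h1 := hw φ hφ
    have h2 := HasWeakDeriv.zero φ hφ
    have h3 := integral_smul_smul (a := a) (b := b) (deriv φ) 0 0
    rw [smul_zero, zero_mul] at h3
    rw [h1, h, ← h2, h3])
  have hr : IsContRep f (fun _ => c) := ⟨continuousOn_const, hc⟩
  rw [hr.trace_eq hab hx] at h0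
  refine Lp.ext ?_
  filter_upwards [hc, Lp.coeFn_zero ℂ 2 (volume.restrict (Ioo a b))] with y hy hy0
  rw [hy, h0, hy0]; rfl

/-! ### The transmission system with boundary delay -/

/-- The data of the system: a string `(0, L)` damped on `(α, β)` with `0 < α < β < L`, the delay
`τ > 0`, the wave coefficients `κ₁, κ₂, κ₃ > 0` on `(0, α)`, `(α, β)`, `(β, L)`, the damping
coefficient `δ₁` and the coefficients `δ₃`, `δ₂` of the boundary feedback and of its delayed
part. -/
structure System where
  L : ℝ
  α : ℝ
  β : ℝ
  τ : ℝ
  κ₁ : ℝ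
  κ₂ : ℝ
  κ₃ : ℝ
  δ₁ : ℝ
  δ₂ : ℝ
  δ₃ : ℝ
  α_pos : 0 < α
  α_lt_β : α < β
  β_lt_L : β < L
  τ_pos : 0 < τ
  κ₁_pos : 0 < κ₁
  κ₂_pos : 0 < κ₂
  κ₃_pos : 0 < κ₃

namespace System

/-- Hypothesis (H) on the coefficients. -/
def HypH (P : System) : Prop :=
  0 < P.κ₃ ∧ 0 < P.δ₁ ∧ 0 < P.δ₃ ∧ P.δ₂ ≠ 0 ∧ 1 / (2 * P.κ₃) < P.δ₃ ∧
    |P.δ₂| < 1 / P.κ₃ * √(2 * P.κ₃ * P.δ₃ - 1)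

variable (P : System)

/-- `𝕃² = L²(0, α) × L²(α, β) × L²(β, L)`. -/
abbrev LL2 : Type := L2 0 P.α × L2 P.α P.β × L2 P.β P.L

/-- `ℍ¹_L`: triples `(u, v, w) ∈ H¹(0, α) × H¹(α, β) × H¹(β, L)` with `u(0) = 0`, `u(α) = v(α)`,
`v(β) = w(β)`. -/
def HH1L : Submodule ℂ P.LL2 where
  carrier := {f | f.1 ∈ H1 0 P.α ∧ f.2.1 ∈ H1 P.α P.β ∧ f.2.2 ∈ H1 P.β P.L ∧
    trace f.1 0 = 0 ∧ trace f.1 P.α = trace f.2.1 P.α ∧ trace f.2.1 P.β = trace f.2.2 P.β}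
  add_mem' := by
    rintro f g ⟨f1, f2, f3, f4, f5, f6⟩ ⟨g1, g2, g3, g4, g5, g6⟩
    have h1 := P.α_pos
    have h2 := P.α_lt_β
    have h3 := P.β_lt_L
    refine ⟨add_mem f1 g1, add_mem f2 g2, add_mem f3 g3, ?_, ?_, ?_⟩
    · rw [Prod.fst_add, trace_add h1 f1 g1 (left_mem_Icc.2 h1.le), f4, g4, add_zero]
    · rw [Prod.fst_add, Prod.snd_add, Prod.fst_add, trace_add h1 f1 g1 (right_mem_Icc.2 h1.le),
        trace_add h2 f2 g2 (left_mem_Icc.2 h2.le), f5, g5]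
    · rw [Prod.snd_add, Prod.fst_add, Prod.snd_add, trace_add h2 f2 g2 (right_mem_Icc.2 h2.le),
        trace_add h3 f3 g3 (left_mem_Icc.2 h3.le), f6, g6]
  zero_mem' := by
    have h1 := P.α_pos
    have h2 := P.α_lt_β
    have h3 := P.β_lt_L
    refine ⟨zero_mem _, zero_mem _, zero_mem _, ?_, ?_, ?_⟩
    · exact trace_zero h1 (left_mem_Icc.2 h1.le)
    · exact (trace_zero h1 (right_mem_Icc.2 h1.le)).trans
        (trace_zero h2 (left_mem_Icc.2 h2.le)).symm
    · exact (trace_zero h2 (right_mem_Icc.2 h2.le)).trans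
        (trace_zero h3 (left_mem_Icc.2 h3.le)).symm
  smul_mem' := by
    rintro c f ⟨f1, f2, f3, f4, f5, f6⟩
    have h1 := P.α_pos
    have h2 := P.α_lt_β
    have h3 := P.β_lt_L
    refine ⟨Submodule.smul_mem _ c f1, Submodule.smul_mem _ c f2, Submodule.smul_mem _ c f3,
      ?_, ?_, ?_⟩
    · rw [Prod.smul_fst, trace_smul h1 c f1 (left_mem_Icc.2 h1.le), f4, mul_zero]
    · rw [Prod.smul_fst, Prod.smul_snd, Prod.smul_fst,
        trace_smul h1 c f1 (right_mem_Icc.2 h1.le),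
        trace_smul h2 c f2 (left_mem_Icc.2 h2.le), f5]
    · rw [Prod.smul_snd, Prod.smul_fst, Prod.smul_snd,
        trace_smul h2 c f2 (right_mem_Icc.2 h2.le),
        trace_smul h3 c f3 (left_mem_Icc.2 h3.le), f6]

/-- The energy space `ℋ = ℍ¹_L × 𝕃² × L²(0, 1)`; it is a type of its own, so that it does not
inherit the product norm. -/
def Energy : Type := P.HH1L × P.LL2 × L2 0 1

instance : AddCommGroup P.Energy := inferInstanceAs (AddCommGroup (P.HH1L × P.LL2 × L2 0 1))
instance : Module ℂ P.Energy := inferInstanceAs (Module ℂ (P.HH1L × P.LL2 × L2 0 1))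

variable {P}

/-! The components of `U = (u, v, w, y, z, φ, η) ∈ ℋ`. -/

def Energy.u (U : P.Energy) : L2 0 P.α := U.1.1.1
def Energy.v (U : P.Energy) : L2 P.α P.β := U.1.1.2.1
def Energy.w (U : P.Energy) : L2 P.β P.L := U.1.1.2.2
def Energy.y (U : P.Energy) : L2 0 P.α := U.2.1.1
def Energy.z (U : P.Energy) : L2 P.α P.β := U.2.1.2.1
def Energy.φ (U : P.Energy) : L2 P.β P.L := U.2.1.2.2
def Energy.η (U : P.Energy) : L2 0 1 := U.2.2

theorem Energy.mem_HH1L (U : P.Energy) : (U.u, U.v, U.w) ∈ P.HH1L := U.1.2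
theorem Energy.u_mem (U : P.Energy) : U.u ∈ H1 0 P.α := U.1.2.1
theorem Energy.v_mem (U : P.Energy) : U.v ∈ H1 P.α P.β := U.1.2.2.1
theorem Energy.w_mem (U : P.Energy) : U.w ∈ H1 P.β P.L := U.1.2.2.2.1

/-- The inner product of the energy space (conjugate linear in the first argument, as in Mathlib;
`energyInner V U` is the usual `⟨U, V⟩`): `κ₁ ∫ u_x ũ_x + κ₂ ∫ v_x ṽ_x + κ₃ ∫ w_x w̃_x
+ ∫ y ỹ + ∫ z z̃ + ∫ φ φ̃ + τ ∫ η η̃`, one factor being conjugated. -/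
def energyInner (U V : P.Energy) : ℂ :=
  P.κ₁ * inner ℂ (wderiv U.u) (wderiv V.u) + P.κ₂ * inner ℂ (wderiv U.v) (wderiv V.v)
    + P.κ₃ * inner ℂ (wderiv U.w) (wderiv V.w)
    + inner ℂ U.y V.y + inner ℂ U.z V.z + inner ℂ U.φ V.φ + P.τ * inner ℂ U.η V.η

theorem energyInner_self_re (U : P.Energy) : (energyInner U U).re =
    P.κ₁ * ‖wderiv U.u‖ ^ 2 + P.κ₂ * ‖wderiv U.v‖ ^ 2 + P.κ₃ * ‖wderiv U.w‖ ^ 2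
    + ‖U.y‖ ^ 2 + ‖U.z‖ ^ 2 + ‖U.φ‖ ^ 2 + P.τ * ‖U.η‖ ^ 2 := by
  simp only [energyInner, inner_self_eq_norm_sq_to_K, Complex.add_re, Complex.re_ofReal_mul,
    ← Complex.ofReal_pow, Complex.coe_algebraMap, Complex.ofReal_re]

theorem eq_zero_of_energyInner (U : P.Energy) (h : energyInner U U = 0) : U = 0 := by
  have hre := energyInner_self_re U
  rw [h, Complex.zero_re] at hre
  have k1 := mul_nonneg P.κ₁_pos.le (sq_nonneg ‖wderiv U.u‖)
  have k2 := mul_nonneg P.κ₂_pos.le (sq_nonneg ‖wderiv U.v‖)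
  have k3 := mul_nonneg P.κ₃_pos.le (sq_nonneg ‖wderiv U.w‖)
  have k4 := sq_nonneg ‖U.y‖
  have k5 := sq_nonneg ‖U.z‖
  have k6 := sq_nonneg ‖U.φ‖
  have k7 := mul_nonneg P.τ_pos.le (sq_nonneg ‖U.η‖)
  have aux : ∀ {c x : ℝ}, 0 < c → c * x ^ 2 = 0 → x = 0 := fun hc hx =>
    pow_eq_zero_iff two_ne_zero |>.1 ((mul_eq_zero.1 hx).resolve_left hc.ne')
  have e1 : wderiv U.u = 0 := norm_eq_zero.1 (aux P.κ₁_pos (by linarith))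
  have e2 : wderiv U.v = 0 := norm_eq_zero.1 (aux P.κ₂_pos (by linarith))
  have e3 : wderiv U.w = 0 := norm_eq_zero.1 (aux P.κ₃_pos (by linarith))
  have e4 : U.y = 0 := norm_eq_zero.1 (aux one_pos (by linarith))
  have e5 : U.z = 0 := norm_eq_zero.1 (aux one_pos (by linarith))
  have e6 : U.φ = 0 := norm_eq_zero.1 (aux one_pos (by linarith))
  have e7 : U.η = 0 := norm_eq_zero.1 (aux P.τ_pos (by linarith))
  obtain ⟨m1, m2, m3, m4, m5, m6⟩ := U.mem_HH1L
  have h1 := P.α_pos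
  have h2 := P.α_lt_β
  have h3 := P.β_lt_L
  have f1 : U.u = 0 := eq_zero_of_wderiv_eq_zero h1 m1 e1 (left_mem_Icc.2 h1.le) m4
  have f2 : U.v = 0 := eq_zero_of_wderiv_eq_zero h2 m2 e2 (left_mem_Icc.2 h2.le) (by
    dsimp only at m5
    rw [← m5, f1]; exact trace_zero h1 (right_mem_Icc.2 h1.le))
  have f3 : U.w = 0 := eq_zero_of_wderiv_eq_zero h3 m3 e3 (left_mem_Icc.2 h3.le) (by
    dsimp only at m6
    rw [← m6, f2]; exact trace_zero h2 (right_mem_Icc.2 h2.le))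
  exact Prod.ext (Subtype.ext (Prod.ext f1 (Prod.ext f2 f3)))
    (Prod.ext (Prod.ext e4 (Prod.ext e5 e6)) e7)

/-- `energyInner` is a positive definite Hermitian form on the energy space. -/
@[reducible]
def energyCore (P : System) : InnerProductSpace.Core ℂ P.Energy where
  inner := energyInner
  conj_inner_symm U V := by
    simp only [energyInner, map_add, map_mul, Complex.conj_ofReal, inner_conj_symm]
  re_inner_nonneg U := by
    have := P.κ₁_pos
    have := P.κ₂_pos
    have := P.κ₃_pos
    have := P.τ_pos
    change 0 ≤ (energyInner U U).re
    rw [energyInner_self_re]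
    positivity
  add_left U V W := by
    have h1 : wderiv (U + V).u = wderiv U.u + wderiv V.u := wderiv_add U.u_mem V.u_mem
    have h2 : wderiv (U + V).v = wderiv U.v + wderiv V.v := wderiv_add U.v_mem V.v_mem
    have h3 : wderiv (U + V).w = wderiv U.w + wderiv V.w := wderiv_add U.w_mem V.w_mem
    have h4 : (U + V).y = U.y + V.y := rfl
    have h5 : (U + V).z = U.z + V.z := rfl
    have h6 : (U + V).φ = U.φ + V.φ := rfl
    have h7 : (U + V).η = U.η + V.η := rfl
    simp only [energyInner, h1, h2, h3, h4, h5, h6, h7, inner_add_left]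
    ring
  smul_left U V c := by
    have h1 : wderiv (c • U).u = c • wderiv U.u := wderiv_smul c U.u_mem
    have h2 : wderiv (c • U).v = c • wderiv U.v := wderiv_smul c U.v_mem
    have h3 : wderiv (c • U).w = c • wderiv U.w := wderiv_smul c U.w_mem
    have h4 : (c • U).y = c • U.y := rfl
    have h5 : (c • U).z = c • U.z := rfl
    have h6 : (c • U).φ = c • U.φ := rfl
    have h7 : (c • U).η = c • U.η := rfl
    simp only [energyInner, h1, h2, h3, h4, h5, h6, h7, inner_smul_left]
    ring
  definite U h := eq_zero_of_energyInner U h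

instance : NormedAddCommGroup P.Energy :=
  @InnerProductSpace.Core.toNormedAddCommGroup ℂ _ _ _ _ (energyCore P)

instance : InnerProductSpace ℂ P.Energy := InnerProductSpace.ofCore (energyCore P).toCore

theorem inner_eq (U V : P.Energy) : inner ℂ U V = energyInner U V := rfl

variable (P) in
/-- The domain `D(𝒜)`: all `(u, v, w, y, z, φ, η) ∈ ℍ¹_L × ℍ¹_L × H¹(0, 1)` such that
`u ∈ H²(0, α)`, `κ₂ v + δ₁ z ∈ H²(α, β)`, `w ∈ H²(β, L)`,
`(κ₂ v + δ₁ z)_x(α) = κ₁ u_x(α)`, `(κ₂ v + δ₁ z)_x(β) = κ₃ w_x(β)`,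
`w_x(L) = - δ₃ η(0) - δ₂ η(1)` and `φ(L) = η(0)`. -/
def domA : Submodule ℂ P.Energy where
  carrier := {U |
    (U.y, U.z, U.φ) ∈ P.HH1L ∧ U.η ∈ H1 0 1 ∧
    U.u ∈ H2 0 P.α ∧ (P.κ₂ : ℂ) • U.v + (P.δ₁ : ℂ) • U.z ∈ H2 P.α P.β ∧ U.w ∈ H2 P.β P.L ∧
    trace (wderiv ((P.κ₂ : ℂ) • U.v + (P.δ₁ : ℂ) • U.z)) P.α = P.κ₁ * trace (wderiv U.u) P.α ∧
    trace (wderiv ((P.κ₂ : ℂ) • U.v + (P.δ₁ : ℂ) • U.z)) P.β = P.κ₃ * trace (wderiv U.w) P.β ∧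
    trace (wderiv U.w) P.L = - P.δ₃ * trace U.η 0 - P.δ₂ * trace U.η 1 ∧
    trace U.φ P.L = trace U.η 0}
  add_mem' := by
    rintro U V ⟨a1, a2, a3, a4, a5, a6, a7, a8, a9⟩ ⟨b1, b2, b3, b4, b5, b6, b7, b8, b9⟩
    have l1 := P.α_pos
    have l2 := P.α_lt_β
    have l3 := P.β_lt_L
    have hq : (P.κ₂ : ℂ) • (U + V).v + (P.δ₁ : ℂ) • (U + V).z
        = ((P.κ₂ : ℂ) • U.v + (P.δ₁ : ℂ) • U.z) + ((P.κ₂ : ℂ) • V.v + (P.δ₁ : ℂ) • V.z) := by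
      change (P.κ₂ : ℂ) • (U.v + V.v) + (P.δ₁ : ℂ) • (U.z + V.z) = _
      rw [smul_add, smul_add]; abel
    have hu : (U + V).u = U.u + V.u := rfl
    have hw : (U + V).w = U.w + V.w := rfl
    have hη : (U + V).η = U.η + V.η := rfl
    have hφ : (U + V).φ = U.φ + V.φ := rfl
    refine ⟨add_mem a1 b1, add_mem a2 b2, add_mem a3 b3, ?_, add_mem a5 b5, ?_, ?_, ?_, ?_⟩
    · rw [hq]; exact add_mem a4 b4
    · rw [hq, hu, wderiv_add a4.1 b4.1, wderiv_add a3.1 b3.1,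
        trace_add l2 a4.2 b4.2 (left_mem_Icc.2 l2.le),
        trace_add l1 a3.2 b3.2 (right_mem_Icc.2 l1.le), a6, b6]; ring
    · rw [hq, hw, wderiv_add a4.1 b4.1, wderiv_add a5.1 b5.1,
        trace_add l2 a4.2 b4.2 (right_mem_Icc.2 l2.le),
        trace_add l3 a5.2 b5.2 (left_mem_Icc.2 l3.le), a7, b7]; ring
    · rw [hw, hη, wderiv_add a5.1 b5.1, trace_add l3 a5.2 b5.2 (right_mem_Icc.2 l3.le),
        trace_add one_pos a2 b2 (by simp), trace_add one_pos a2 b2 (by simp), a8, b8]; ring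
    · rw [hφ, hη, trace_add l3 a1.2.2.1 b1.2.2.1 (right_mem_Icc.2 l3.le),
        trace_add one_pos a2 b2 (by simp), a9, b9]
  zero_mem' := by
    have l1 := P.α_pos
    have l2 := P.α_lt_β
    have l3 := P.β_lt_L
    have hu : (0 : P.Energy).u = 0 := rfl
    have hv : (0 : P.Energy).v = 0 := rfl
    have hw : (0 : P.Energy).w = 0 := rfl
    have hz : (0 : P.Energy).z = 0 := rfl
    have hη : (0 : P.Energy).η = 0 := rfl
    have hφ : (0 : P.Energy).φ = 0 := rfl
    have hq : (P.κ₂ : ℂ) • (0 : P.Energy).v + (P.δ₁ : ℂ) • (0 : P.Energy).z = 0 := by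
      rw [hv, hz, smul_zero, smul_zero, add_zero]
    refine ⟨zero_mem _, zero_mem _, zero_mem _, ?_, zero_mem _, ?_, ?_, ?_, ?_⟩
    · rw [hq]; exact zero_mem _
    · rw [hq, hu, wderiv_zero, wderiv_zero, trace_zero l2 (left_mem_Icc.2 l2.le),
        trace_zero l1 (right_mem_Icc.2 l1.le), mul_zero]
    · rw [hq, hw, wderiv_zero, wderiv_zero, trace_zero l2 (right_mem_Icc.2 l2.le),
        trace_zero l3 (left_mem_Icc.2 l3.le), mul_zero]
    · rw [hw, hη, wderiv_zero, trace_zero l3 (right_mem_Icc.2 l3.le),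
        trace_zero one_pos (by simp), trace_zero one_pos (by simp)]; ring
    · rw [hφ, hη, trace_zero l3 (right_mem_Icc.2 l3.le), trace_zero one_pos (by simp)]
  smul_mem' := by
    rintro c U ⟨a1, a2, a3, a4, a5, a6, a7, a8, a9⟩
    have l1 := P.α_pos
    have l2 := P.α_lt_β
    have l3 := P.β_lt_L
    have hq : (P.κ₂ : ℂ) • (c • U).v + (P.δ₁ : ℂ) • (c • U).z
        = c • ((P.κ₂ : ℂ) • U.v + (P.δ₁ : ℂ) • U.z) := by
      change (P.κ₂ : ℂ) • (c • U.v) + (P.δ₁ : ℂ) • (c • U.z) = _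
      rw [smul_add, smul_comm c, smul_comm c]
    have hu : (c • U).u = c • U.u := rfl
    have hw : (c • U).w = c • U.w := rfl
    have hη : (c • U).η = c • U.η := rfl
    have hφ : (c • U).φ = c • U.φ := rfl
    refine ⟨Submodule.smul_mem _ c a1, Submodule.smul_mem _ c a2, Submodule.smul_mem _ c a3, ?_,
      Submodule.smul_mem _ c a5, ?_, ?_, ?_, ?_⟩
    · rw [hq]; exact Submodule.smul_mem _ c a4
    · rw [hq, hu, wderiv_smul c a4.1, wderiv_smul c a3.1,
        trace_smul l2 c a4.2 (left_mem_Icc.2 l2.le),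
        trace_smul l1 c a3.2 (right_mem_Icc.2 l1.le), a6]; ring
    · rw [hq, hw, wderiv_smul c a4.1, wderiv_smul c a5.1,
        trace_smul l2 c a4.2 (right_mem_Icc.2 l2.le),
        trace_smul l3 c a5.2 (left_mem_Icc.2 l3.le), a7]; ring
    · rw [hw, hη, wderiv_smul c a5.1, trace_smul l3 c a5.2 (right_mem_Icc.2 l3.le),
        trace_smul one_pos c a2 (by simp), trace_smul one_pos c a2 (by simp), a8]; ring
    · rw [hφ, hη, trace_smul l3 c a1.2.2.1 (right_mem_Icc.2 l3.le),
        trace_smul one_pos c a2 (by simp), a9]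

variable (P) in
/-- The operator `𝒜 U = (y, z, φ, κ₁ u_xx, (κ₂ v + δ₁ z)_xx, κ₃ w_xx, - τ⁻¹ η_ρ)` with domain
`D(𝒜)`. -/
def opA : P.Energy →ₗ.[ℂ] P.Energy where
  domain := P.domA
  toFun :=
    { toFun := fun U =>
        (⟨(U.1.y, U.1.z, U.1.φ), U.2.1⟩,
          ((P.κ₁ : ℂ) • wderiv (wderiv U.1.u),
            wderiv (wderiv ((P.κ₂ : ℂ) • U.1.v + (P.δ₁ : ℂ) • U.1.z)),
            (P.κ₃ : ℂ) • wderiv (wderiv U.1.w)),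
          (-(P.τ : ℂ)⁻¹) • wderiv U.1.η)
      map_add' := by
        rintro ⟨U, a1, a2, a3, a4, a5, -⟩ ⟨V, b1, b2, b3, b4, b5, -⟩
        have hq : (P.κ₂ : ℂ) • (U + V).v + (P.δ₁ : ℂ) • (U + V).z
            = ((P.κ₂ : ℂ) • U.v + (P.δ₁ : ℂ) • U.z)
              + ((P.κ₂ : ℂ) • V.v + (P.δ₁ : ℂ) • V.z) := by
          change (P.κ₂ : ℂ) • (U.v + V.v) + (P.δ₁ : ℂ) • (U.z + V.z) = _
          rw [smul_add, smul_add]; abel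
        refine Prod.ext rfl (Prod.ext (Prod.ext ?_ (Prod.ext ?_ ?_)) ?_)
        · change (P.κ₁ : ℂ) • wderiv (wderiv (U.u + V.u))
            = (P.κ₁ : ℂ) • wderiv (wderiv U.u) + (P.κ₁ : ℂ) • wderiv (wderiv V.u)
          rw [wderiv_add a3.1 b3.1, wderiv_add a3.2 b3.2, smul_add]
        · change wderiv (wderiv ((P.κ₂ : ℂ) • (U + V).v + (P.δ₁ : ℂ) • (U + V).z))
            = wderiv (wderiv ((P.κ₂ : ℂ) • U.v + (P.δ₁ : ℂ) • U.z))
              + wderiv (wderiv ((P.κ₂ : ℂ) • V.v + (P.δ₁ : ℂ) • V.z))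
          rw [hq, wderiv_add a4.1 b4.1, wderiv_add a4.2 b4.2]
        · change (P.κ₃ : ℂ) • wderiv (wderiv (U.w + V.w))
            = (P.κ₃ : ℂ) • wderiv (wderiv U.w) + (P.κ₃ : ℂ) • wderiv (wderiv V.w)
          rw [wderiv_add a5.1 b5.1, wderiv_add a5.2 b5.2, smul_add]
        · change (-(P.τ : ℂ)⁻¹) • wderiv (U.η + V.η)
            = (-(P.τ : ℂ)⁻¹) • wderiv U.η + (-(P.τ : ℂ)⁻¹) • wderiv V.η
          rw [wderiv_add a2 b2, smul_add]
      map_smul' := by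
        rintro c ⟨U, a1, a2, a3, a4, a5, -⟩
        have hq : (P.κ₂ : ℂ) • (c • U).v + (P.δ₁ : ℂ) • (c • U).z
            = c • ((P.κ₂ : ℂ) • U.v + (P.δ₁ : ℂ) • U.z) := by
          change (P.κ₂ : ℂ) • (c • U.v) + (P.δ₁ : ℂ) • (c • U.z) = _
          rw [smul_add, smul_comm c, smul_comm c]
        refine Prod.ext rfl (Prod.ext (Prod.ext ?_ (Prod.ext ?_ ?_)) ?_)
        · change (P.κ₁ : ℂ) • wderiv (wderiv (c • U.u)) = c • (P.κ₁ : ℂ) • wderiv (wderiv U.u)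
          rw [wderiv_smul c a3.1, wderiv_smul c a3.2, smul_comm]
        · change wderiv (wderiv ((P.κ₂ : ℂ) • (c • U).v + (P.δ₁ : ℂ) • (c • U).z))
            = c • wderiv (wderiv ((P.κ₂ : ℂ) • U.v + (P.δ₁ : ℂ) • U.z))
          rw [hq, wderiv_smul c a4.1, wderiv_smul c a4.2]
        · change (P.κ₃ : ℂ) • wderiv (wderiv (c • U.w)) = c • (P.κ₃ : ℂ) • wderiv (wderiv U.w)
          rw [wderiv_smul c a5.1, wderiv_smul c a5.2, smul_comm]
        · change (-(P.τ : ℂ)⁻¹) • wderiv (c • U.η) = c • (-(P.τ : ℂ)⁻¹) • wderiv U.η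
          rw [wderiv_smul c a2, smul_comm] }

end System

end

end BoundaryDelay

namespace BoundaryDelay

noncomputable section

open MeasureTheory Set Filter Topology
open scoped ContDiff

/-! ### The Hille–Yosida theorem for m-dissipative operators -/

section Abstract

variable {E : Type*} [NormedAddCommGroup E] [InnerProductSpace ℂ E]

/-! The proof has an abstract half and a concrete half.

Abstractly, m-dissipativity already implies everything about the semigroup and the Cauchy problem.
Dissipativity bounds `(r - A)⁻¹` by `1/r`, and together with surjectivity it makes the domain dense
in a Hilbert space. The Yosida approximations are bounded, commuting and dissipative and converge to
`A` on the domain. Their exponentials are therefore contractions that converge strongly, and the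
limit is the semigroup. Integrating in time and passing to the limit gives `T t x - x = ∫ T s (A x)`
on the domain, hence strong solutions; density then gives weak solutions. For uniqueness, the
integral `X` of the difference of two weak solutions lies in the domain and satisfies `X' = A X`
(`mem_domain_of_adjoint`), so dissipativity forces `X = 0`.

Concretely, m-dissipativity of `opA` has to be shown on a complete energy space. Integration by
parts leaves, besides the damping term `-δ₁ ‖z_x‖²`, only a quadratic form in `η(0)`, `η(1)`. After
completing the square, (H) makes it nonpositive (`isDissipative_opA`).

For the range condition the unknown is the strain `p` on all of `(0, L)`. Displacement and velocity
are primitives from `0`, so the clamped end and the continuity conditions at `α`, `β` hold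
automatically. The stress has an integrable derivative across `α` and `β`, which encodes the flux
conditions. Solving the transport equation for `η` explicitly turns the delayed feedback into `σ(L)
= -(c φ(L) + d)` for the stress `σ`. Here `Re c ≥ 0`, because (H) gives `|δ₂| ≤ δ₃` and the
homogeneous transport solution does not grow. What remains is one equation for `p` with a bounded
coercive operator on `L²(0, L)` (`exists_stress`), so neither traces nor second derivatives enter
the variational step. -/

theorem hasDerivAt_norm_sq {X : ℝ → E} {X' : E} {t : ℝ} (h : HasDerivAt X X' t) :
    HasDerivAt (fun s => ‖X s‖ ^ 2) (2 * (inner ℂ X' (X t)).re) t := by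
  have h1 := h.inner ℂ h
  have h2 := (Complex.reCLM.hasFDerivAt.comp_hasDerivAt t h1)
  have e : (fun s => ‖X s‖ ^ 2) = Complex.reCLM ∘ fun s => inner ℂ (X s) (X s) := by
    ext s
    simp [inner_self_eq_norm_sq_to_K, ← Complex.ofReal_pow]
  rw [e]
  refine h2.congr_deriv ?_
  change ((inner ℂ (X t) X' : ℂ) + inner ℂ X' (X t)).re = _
  rw [Complex.add_re]
  have : (inner ℂ (X t) X').re = (inner ℂ X' (X t)).re := inner_re_symm (𝕜 := ℂ) _ _
  rw [this]; ring

/-- The derivative of `‖X‖²` is `2 Re ⟨Y, X⟩ ≤ 0`. This one estimate gives both contractivity of the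
exponentials and uniqueness of weak solutions. -/
theorem norm_le_norm_zero_of_dissipative {X Y : ℝ → E}
    (h : ∀ t, 0 ≤ t → HasDerivAt X (Y t) t) (hd : ∀ t, 0 ≤ t → (inner ℂ (Y t) (X t)).re ≤ 0)
    {t : ℝ} (ht : 0 ≤ t) : ‖X t‖ ≤ ‖X 0‖ := by
  have ha : AntitoneOn (fun s => ‖X s‖ ^ 2) (Ici 0) := by
    refine antitoneOn_of_deriv_nonpos (convex_Ici 0) ?_ ?_ ?_
    · exact fun s hs => (hasDerivAt_norm_sq (h s hs)).continuousAt.continuousWithinAt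
    · intro s hs
      rw [interior_Ici] at hs
      exact (hasDerivAt_norm_sq (h s (le_of_lt hs))).differentiableAt.differentiableWithinAt
    · intro s hs
      rw [interior_Ici] at hs
      rw [(hasDerivAt_norm_sq (h s (le_of_lt hs))).deriv]
      linarith [hd s (le_of_lt hs)]
  have := ha (self_mem_Ici) ht ht
  exact le_of_sq_le_sq this (norm_nonneg _)

/-! ### Resolvent estimates, density of the domain, Yosida approximation. -/

namespace IsMDissipative

variable {A : E →ₗ.[ℂ] E}

/-- Dissipativity gives `r ‖x‖² ≤ Re ⟨(r - A) x, x⟩`; Cauchy–Schwarz and division by `‖x‖` finish.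
-/
theorem smul_norm_le (hA : IsDissipative A) {r : ℝ} (x : A.domain) :
    r * ‖(x : E)‖ ≤ ‖(r : ℂ) • (x : E) - A x‖ := by
  have h1 := hA x
  have h2 : (inner ℂ ((r : ℂ) • (x : E) - A x) (x : E)).re ≤
      ‖(r : ℂ) • (x : E) - A x‖ * ‖(x : E)‖ := re_inner_le_norm (𝕜 := ℂ) _ _
  have h3 : (inner ℂ ((r : ℂ) • (x : E) - A x) (x : E)).re
      = r * ‖(x : E)‖ ^ 2 - (inner ℂ (A x) (x : E)).re := by
    simp [inner_self_eq_norm_sq_to_K, ← Complex.ofReal_pow]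
  rcases (norm_nonneg (x : E)).eq_or_lt with h0 | h0
  · rw [← h0]; simp
  · refine le_of_mul_le_mul_right ?_ h0
    nlinarith

theorem eq_of_sub_eq (hA : IsDissipative A) {r : ℝ} (hr : 0 < r) {x y : A.domain}
    (h : (r : ℂ) • (x : E) - A x = (r : ℂ) • (y : E) - A y) : x = y := by
  have h1 := smul_norm_le hA (r := r) (x - y)
  have h2 : (r : ℂ) • ((x - y : A.domain) : E) - A (x - y) = 0 := by
    rw [LinearPMap.map_sub, AddSubgroupClass.coe_sub, smul_sub]
    rw [← sub_eq_zero] at h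
    rw [← h]; abel
  rw [h2, norm_zero] at h1
  have h3 : ‖((x - y : A.domain) : E)‖ = 0 := by
    refine le_antisymm ?_ (norm_nonneg _)
    by_contra hc
    push Not at hc
    nlinarith [mul_pos hr hc]
  rw [norm_eq_zero, AddSubgroupClass.coe_sub, sub_eq_zero] at h3
  exact Subtype.ext h3

theorem exists_sub_eq (hA : IsMDissipative A) (f : E) : ∃ x : A.domain, (x : E) - A x = f := by
  obtain ⟨x, hx⟩ := hA.2 1 one_pos f
  exact ⟨x, by simpa using hx⟩

/-- Preimages under `r - A` are unique by dissipativity, so an arbitrary choice of them is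
automatically linear, and `smul_norm_le` bounds it. -/
theorem exists_resolvent (hA : IsMDissipative A) {r : ℝ} (hr : 0 < r) :
    ∃ R : E →L[ℂ] E, (∀ f, ∃ h : R f ∈ A.domain, (r : ℂ) • R f - A ⟨R f, h⟩ = f) ∧
      (∀ f, r * ‖R f‖ ≤ ‖f‖) := by
  choose g hg using hA.2 r hr
  have hb : ∀ f, r * ‖(g f : E)‖ ≤ ‖f‖ := fun f => by
    have := smul_norm_le hA.1 (r := r) (g f)
    rwa [hg] at this
  let R₀ : E →ₗ[ℂ] E :=
    { toFun := fun f => g f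
      map_add' := fun f f' => by
        rw [← Submodule.coe_add]
        refine congrArg _ (eq_of_sub_eq hA.1 hr ?_)
        rw [hg, LinearPMap.map_add, Submodule.coe_add, smul_add, add_sub_add_comm, hg, hg]
      map_smul' := fun c f => by
        rw [RingHom.id_apply, ← Submodule.coe_smul]
        refine congrArg _ (eq_of_sub_eq hA.1 hr ?_)
        rw [hg, LinearPMap.map_smul, Submodule.coe_smul, smul_comm, ← smul_sub, hg] }
  refine ⟨R₀.mkContinuous r⁻¹ fun f => ?_, fun f => ⟨(g f).2, hg f⟩, hb⟩
  rw [inv_mul_eq_div, le_div_iff₀ hr, mul_comm]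
  exact hb f

/-- The resolvent `(r - A)⁻¹` of an m-dissipative operator. -/
def resolvent (hA : IsMDissipative A) {r : ℝ} (hr : 0 < r) : E →L[ℂ] E :=
  (exists_resolvent hA hr).choose

section
variable (hA : IsMDissipative A) {r : ℝ} (hr : 0 < r)
include hA hr

theorem resolvent_mem (f : E) : resolvent hA hr f ∈ A.domain :=
  ((exists_resolvent hA hr).choose_spec.1 f).choose

theorem sub_resolvent (f : E) :
    (r : ℂ) • resolvent hA hr f - A ⟨resolvent hA hr f, resolvent_mem hA hr f⟩ = f :=
  ((exists_resolvent hA hr).choose_spec.1 f).choose_spec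

theorem resolvent_sub (x : A.domain) : resolvent hA hr ((r : ℂ) • (x : E) - A x) = x := by
  have := eq_of_sub_eq hA.1 hr (x := ⟨_, resolvent_mem hA hr _⟩)
    (sub_resolvent hA hr ((r : ℂ) • (x : E) - A x))
  exact congrArg Subtype.val this

theorem resolvent_map (x : A.domain) :
    resolvent hA hr (A x) = (r : ℂ) • resolvent hA hr x - x := by
  have := resolvent_sub hA hr x
  rw [map_sub, map_smul] at this
  rw [eq_sub_iff_add_eq, add_comm, ← eq_sub_iff_add_eq, this]

theorem norm_resolvent_le (f : E) : r * ‖resolvent hA hr f‖ ≤ ‖f‖ :=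
  (exists_resolvent hA hr).choose_spec.2 f

/-- By the resolvent identity both products, multiplied by `s - r`, equal `R_r f - R_s f`; the case
`s = r` is trivial. -/
theorem resolvent_comm {s : ℝ} (hs : 0 < s) (f : E) :
    resolvent hA hr (resolvent hA hs f) = resolvent hA hs (resolvent hA hr f) := by
  have e1 := sub_resolvent hA hr f
  have e2 := sub_resolvent hA hs f
  have h1 := resolvent_map hA hr ⟨_, resolvent_mem hA hs f⟩
  have h2 := resolvent_map hA hs ⟨_, resolvent_mem hA hr f⟩
  rw [sub_eq_iff_eq_add, ← sub_eq_iff_eq_add'] at e1 e2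
  rw [← e2, map_sub, map_smul] at h1
  rw [← e1, map_sub, map_smul] at h2
  dsimp only at h1 h2
  set a := resolvent hA hr f
  set b := resolvent hA hs f
  set X := resolvent hA hr b
  set Y := resolvent hA hs a
  have h3 : ((s : ℂ) - r) • X = a - b := by
    linear_combination (norm := module) h1
  have h4 : ((s : ℂ) - r) • Y = a - b := by
    linear_combination (norm := module) -h2
  by_cases hrs : s = r
  · subst hrs; rfl
  · have : (s : ℂ) - r ≠ 0 := by
      rw [sub_ne_zero]; exact_mod_cast hrs
    exact smul_right_injective E this (h3.trans h4.symm)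

end

/-- If `f` is orthogonal to the domain, write `f = x - A x`. Pairing with `x` gives `‖x‖² = Re ⟨A x,
x⟩ ≤ 0`, so `x = 0` and `f = 0`. -/
theorem dense_domain [CompleteSpace E] (hA : IsMDissipative A) : Dense (A.domain : Set E) := by
  rw [Submodule.dense_iff_topologicalClosure_eq_top, Submodule.topologicalClosure_eq_top_iff,
    Submodule.eq_bot_iff]
  intro f hf
  have h1 := sub_resolvent hA one_pos f
  set x : A.domain := ⟨_, resolvent_mem hA one_pos f⟩ with hx
  change ((1 : ℝ) : ℂ) • (x : E) - A x = f at h1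
  have h2 := (Submodule.mem_orthogonal' _ _).1 hf x x.2
  have h3 := hA.1 x
  rw [← h1, inner_sub_left] at h2
  have h4 := congrArg Complex.re h2
  simp only [Complex.ofReal_one, one_smul, Complex.sub_re, inner_self_eq_norm_sq_to_K,
    Complex.zero_re] at h4
  have h5 : ‖(x : E)‖ ^ 2 ≤ 0 := by
    have : ((‖(x : E)‖ : ℂ) ^ 2).re = ‖(x : E)‖ ^ 2 := by
      rw [← Complex.ofReal_pow, Complex.ofReal_re]
    change ((‖(x : E)‖ : ℂ) ^ 2).re - _ = 0 at h4
    rw [this] at h4; linarith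
  have h6 : (x : E) = 0 := by
    have : ‖(x : E)‖ = 0 := by nlinarith [norm_nonneg (x : E)]
    exact norm_eq_zero.1 this
  have h7 : x = 0 := Subtype.ext h6
  rw [← h1, h7]; simp

/-- The Yosida approximation `r (r (r - A)⁻¹ - 1)` of `A`. -/
def yosida (hA : IsMDissipative A) {r : ℝ} (hr : 0 < r) : E →L[ℂ] E :=
  (r : ℂ) • ((r : ℂ) • resolvent hA hr - ContinuousLinearMap.id ℂ E)

section
variable (hA : IsMDissipative A) {r : ℝ} (hr : 0 < r)
include hA hr

theorem yosida_apply (x : E) :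
    yosida hA hr x = (r : ℂ) • ((r : ℂ) • resolvent hA hr x - x) := rfl

theorem yosida_apply_domain (x : A.domain) :
    yosida hA hr x = (r : ℂ) • resolvent hA hr (A x) := by
  rw [yosida_apply, resolvent_map]

theorem norm_smul_resolvent_le (x : E) : ‖(r : ℂ) • resolvent hA hr x‖ ≤ ‖x‖ := by
  rw [norm_smul, Complex.norm_real, Real.norm_of_nonneg hr.le]
  exact norm_resolvent_le hA hr x

/-- Since `r (r - A)⁻¹` is a contraction `J`, `Re ⟨J x, x⟩ ≤ ‖x‖²`. -/
theorem yosida_dissipative (x : E) : (inner ℂ (yosida hA hr x) x).re ≤ 0 := by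
  rw [yosida_apply, inner_smul_left, Complex.conj_ofReal, Complex.re_ofReal_mul, inner_sub_left,
    Complex.sub_re]
  have h1 : (inner ℂ ((r : ℂ) • resolvent hA hr x) x).re ≤ _ := re_inner_le_norm (𝕜 := ℂ) _ _
  have h2 := norm_smul_resolvent_le hA hr x
  have h3 : (inner ℂ x x : ℂ).re = ‖x‖ ^ 2 := by
    simp [inner_self_eq_norm_sq_to_K, ← Complex.ofReal_pow]
  rw [h3]
  refine mul_nonpos_of_nonneg_of_nonpos hr.le ?_
  nlinarith [norm_nonneg x, mul_le_mul_of_nonneg_right h2 (norm_nonneg x)]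

theorem yosida_commute {s : ℝ} (hs : 0 < s) : Commute (yosida hA hr) (yosida hA hs) := by
  have : Commute (resolvent hA hr) (resolvent hA hs) :=
    ContinuousLinearMap.ext fun x => resolvent_comm hA hr hs x
  exact ((((this.smul_left _).smul_right _).sub_left (Commute.one_left _)).sub_right
    (Commute.one_right _) |>.smul_left _ |>.smul_right _)

end

/-- On the domain, `r R y - y = R (A y)` has norm at most `‖A y‖ / r`. The contraction bound on `r
R` extends the limit to all `x` by density. Taking `r = n + 1` keeps the parameter positive for
every `n`. -/
theorem tendsto_smul_resolvent [CompleteSpace E] (hA : IsMDissipative A) (x : E) :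
    Tendsto (fun n : ℕ => ((n + 1 : ℝ) : ℂ) • resolvent hA (Nat.cast_add_one_pos n) x) atTop
      (𝓝 x) := by
  rw [Metric.tendsto_atTop]
  intro ε hε
  obtain ⟨y, hy, hxy⟩ := Metric.dense_iff.1 (dense_domain hA) x (ε / 3) (by positivity)
  obtain ⟨N, hN⟩ := exists_nat_gt (‖A ⟨y, hxy⟩‖ / (ε / 3))
  refine ⟨N, fun n hn => ?_⟩
  have hn0 : (0 : ℝ) < n + 1 := Nat.cast_add_one_pos n
  set R := resolvent hA (Nat.cast_add_one_pos (α := ℝ) n)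
  have h1 : ‖((n + 1 : ℝ) : ℂ) • R (x - y)‖ ≤ ‖x - y‖ := norm_smul_resolvent_le hA hn0 _
  have h2 : R (A ⟨y, hxy⟩) = ((n + 1 : ℝ) : ℂ) • R y - y := resolvent_map hA hn0 ⟨y, hxy⟩
  have h3 : (n + 1 : ℝ) * ‖R (A ⟨y, hxy⟩)‖ ≤ ‖A ⟨y, hxy⟩‖ := norm_resolvent_le hA hn0 _
  have h4 : ‖R (A ⟨y, hxy⟩)‖ < ε / 3 := by
    rw [div_lt_iff₀ (by positivity)] at hN
    have : (N : ℝ) ≤ n := by exact_mod_cast hn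
    by_contra hc
    push Not at hc
    nlinarith [mul_le_mul_of_nonneg_left hc hn0.le]
  have h5 : ‖x - y‖ < ε / 3 := by
    rw [Metric.mem_ball, dist_comm, dist_eq_norm] at hy; exact hy
  rw [dist_eq_norm]
  have e : ((n + 1 : ℝ) : ℂ) • R x - x
      = ((n + 1 : ℝ) : ℂ) • R (x - y) + R (A ⟨y, hxy⟩) - (x - y) := by
    rw [h2, map_sub, smul_sub]; abel
  rw [e]
  calc _ ≤ ‖((n + 1 : ℝ) : ℂ) • R (x - y)‖ + ‖R (A ⟨y, hxy⟩)‖ + ‖x - y‖ :=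
        (norm_sub_le _ _).trans (by gcongr; exact norm_add_le _ _)
    _ < ε := by linarith

theorem tendsto_yosida [CompleteSpace E] (hA : IsMDissipative A) (x : A.domain) :
    Tendsto (fun n : ℕ => yosida hA (Nat.cast_add_one_pos (α := ℝ) n) x) atTop (𝓝 (A x)) := by
  simp_rw [yosida_apply_domain]
  exact tendsto_smul_resolvent hA (A x)

end IsMDissipative
end Abstract

/-! ### Exponentials of bounded dissipative operators. -/

section Abstract

variable {E : Type*} [NormedAddCommGroup E] [InnerProductSpace ℂ E] [CompleteSpace E]

theorem hasDerivAt_exp_apply (B : E →L[ℂ] E) (x : E) (t : ℝ) :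
    HasDerivAt (fun s : ℝ => NormedSpace.exp (s • B) x) (NormedSpace.exp (t • B) (B x)) t :=
  (((ContinuousLinearMap.apply ℂ E x).restrictScalars ℝ).hasFDerivAt).comp_hasDerivAt t
    (hasDerivAt_exp_smul_const B t)

theorem commute_exp_smul {B C : E →L[ℂ] E} (h : Commute B C) (t : ℝ) :
    Commute (NormedSpace.exp (t • B)) C :=
  (h.smul_left t).exp_left

theorem norm_exp_apply_le {B : E →L[ℂ] E} (hB : ∀ x, (inner ℂ (B x) x).re ≤ 0) {t : ℝ}
    (ht : 0 ≤ t) (x : E) : ‖NormedSpace.exp (t • B) x‖ ≤ ‖x‖ := by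
  have := norm_le_norm_zero_of_dissipative (X := fun s : ℝ => NormedSpace.exp (s • B) x)
    (Y := fun s => NormedSpace.exp (s • B) (B x)) (fun s _ => hasDerivAt_exp_apply B x s)
    (fun s _ => by
      have e : NormedSpace.exp (s • B) (B x) = B (NormedSpace.exp (s • B) x) :=
        DFunLike.congr_fun (commute_exp_smul (Commute.refl B) s) x
      rw [e]; exact hB _) ht
  simpa using this

/-- Interpolate by `s ↦ exp (s B) exp ((t - s) C) x` between the two exponentials. Because `B` and
`C` commute, its derivative is the same product applied to `B x - C x`, and both factors are
contractions. -/
theorem norm_exp_apply_sub_le {B C : E →L[ℂ] E} (hB : ∀ x, (inner ℂ (B x) x).re ≤ 0)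
    (hC : ∀ x, (inner ℂ (C x) x).re ≤ 0) (hBC : Commute B C) {t : ℝ} (ht : 0 ≤ t) (x : E) :
    ‖NormedSpace.exp (t • B) x - NormedSpace.exp (t • C) x‖ ≤ t * ‖B x - C x‖ := by
  have hd : ∀ s : ℝ, HasDerivAt
      (fun s : ℝ => (NormedSpace.exp (s • B) * NormedSpace.exp ((t - s) • C)) x)
      ((NormedSpace.exp (s • B) * NormedSpace.exp ((t - s) • C)) (B x - C x)) s := by
    intro s
    have h1 := hasDerivAt_exp_smul_const B s
    have h2 := (hasDerivAt_exp_smul_const C (t - s)).scomp s ((hasDerivAt_id s).const_sub t)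
    have h3 := (((ContinuousLinearMap.apply ℂ E x).restrictScalars ℝ).hasFDerivAt).comp_hasDerivAt s
      (h1.mul h2)
    refine h3.congr_deriv ?_
    have e : B * NormedSpace.exp ((t - s) • C) = NormedSpace.exp ((t - s) • C) * B :=
      ((commute_exp_smul hBC.symm (t - s)).eq).symm
    simp only [Function.comp_apply, neg_smul, one_smul, mul_neg]
    rw [mul_assoc, e]
    simp [sub_eq_add_neg]
  have := norm_image_sub_le_of_norm_deriv_le_segment' (a := 0) (b := t) (C := ‖B x - C x‖)
    (fun r _ => (hd r).hasDerivWithinAt)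
    (fun r hr => (norm_exp_apply_le hB hr.1 _).trans
      (norm_exp_apply_le hC (sub_nonneg.2 hr.2.le) _)) t (right_mem_Icc.2 ht)
  simpa [mul_comm] using this

/-! ### The limit semigroup and its generator. -/

namespace IsMDissipative

variable {A : E →ₗ.[ℂ] E} (hA : IsMDissipative A)

/-- The semigroup generated by the `n`-th Yosida approximation. -/
def approx (n : ℕ) (t : ℝ) : E →L[ℂ] E :=
  NormedSpace.exp (t • yosida hA (Nat.cast_add_one_pos (α := ℝ) n))

theorem norm_approx_le (n : ℕ) {t : ℝ} (ht : 0 ≤ t) (x : E) : ‖approx hA n t x‖ ≤ ‖x‖ :=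
  norm_exp_apply_le (yosida_dissipative hA _) ht x

theorem norm_approx_sub_le (n m : ℕ) {t : ℝ} (ht : 0 ≤ t) (x : E) :
    ‖approx hA n t x - approx hA m t x‖ ≤
      t * ‖yosida hA (Nat.cast_add_one_pos (α := ℝ) n) x
        - yosida hA (Nat.cast_add_one_pos (α := ℝ) m) x‖ :=
  norm_exp_apply_sub_le (yosida_dissipative hA _) (yosida_dissipative hA _)
    (yosida_commute hA _ _) ht x

theorem approx_add (n : ℕ) (s t : ℝ) (x : E) :
    approx hA n (s + t) x = approx hA n s (approx hA n t x) := by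
  let _ : NormedAlgebra ℚ (E →L[ℂ] E) := NormedAlgebra.restrictScalars ℚ ℝ _
  rw [approx, add_smul, NormedSpace.exp_add_of_commute
    (((Commute.refl _).smul_left s).smul_right t)]
  rfl

theorem continuous_approx (n : ℕ) (x : E) : Continuous fun t => approx hA n t x :=
  continuous_iff_continuousAt.2 fun t => (hasDerivAt_exp_apply _ x t).continuousAt

theorem approx_sub_eq_integral (n : ℕ) (t : ℝ) (x : E) :
    approx hA n t x - x = ∫ s in (0 : ℝ)..t,
      approx hA n s (yosida hA (Nat.cast_add_one_pos (α := ℝ) n) x) := by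
  unfold approx
  rw [intervalIntegral.integral_eq_sub_of_hasDerivAt
    (fun s _ => hasDerivAt_exp_apply (yosida hA (Nat.cast_add_one_pos (α := ℝ) n)) x s)
    ((continuous_approx hA n _).intervalIntegrable _ _)]
  simp

/-- For `y` in the domain, the exponentials differ by at most `t` times the difference of the Yosida
approximations at `y`, which converge. Contractivity transfers the Cauchy property to the closure of
the domain. -/
theorem exists_tendsto_approx {t : ℝ} (ht : 0 ≤ t) (x : E) :
    ∃ y, Tendsto (fun n => approx hA n t x) atTop (𝓝 y) := by
  refine cauchySeq_tendsto_of_complete (Metric.cauchySeq_iff.2 fun ε hε => ?_)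
  obtain ⟨y, hy, hxy⟩ := Metric.dense_iff.1 (dense_domain hA) x (ε / 4) (by positivity)
  obtain ⟨N, hN⟩ := Metric.cauchySeq_iff.1 (tendsto_yosida hA ⟨y, hxy⟩).cauchySeq
    -- Using `t + 1` instead of `t` keeps the denominator positive at `t = 0`.
    (ε / (4 * (t + 1))) (by positivity)
  refine ⟨N, fun m hm n hn => ?_⟩
  have h1 := hN m hm n hn
  rw [dist_eq_norm] at h1 ⊢
  have h2 := norm_approx_sub_le hA m n ht y
  have h3 : ‖x - y‖ < ε / 4 := by
    rw [Metric.mem_ball, dist_comm, dist_eq_norm] at hy; exact hy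
  have h4 := norm_approx_le hA m ht (x - y)
  have h5 := norm_approx_le hA n ht (x - y)
  rw [lt_div_iff₀ (by positivity)] at h1
  dsimp only at h1
  have e : approx hA m t x - approx hA n t x = approx hA m t (x - y)
      + (approx hA m t y - approx hA n t y) - approx hA n t (x - y) := by
    rw [map_sub, map_sub]; abel
  rw [e]
  have h6 := norm_sub_le (approx hA m t (x - y) + (approx hA m t y - approx hA n t y))
    (approx hA n t (x - y))
  have h7 := norm_add_le (approx hA m t (x - y)) (approx hA m t y - approx hA n t y)
  set q := ‖yosida hA (Nat.cast_add_one_pos (α := ℝ) m) y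
        - yosida hA (Nat.cast_add_one_pos (α := ℝ) n) y‖ with hq
  have : t * q ≤ ε / 4 := by nlinarith [norm_nonneg (yosida hA (Nat.cast_add_one_pos (α := ℝ) m) y
        - yosida hA (Nat.cast_add_one_pos (α := ℝ) n) y)]
  linarith

theorem exists_semigroup (t : ℝ≥0) : ∃ T : E →L[ℂ] E,
    (∀ x, ‖T x‖ ≤ ‖x‖) ∧ ∀ x, Tendsto (fun n => approx hA n t x) atTop (𝓝 (T x)) := by
  choose f hf using fun x => exists_tendsto_approx hA t.2 x
  have hb : ∀ x, ‖f x‖ ≤ ‖x‖ := fun x =>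
    le_of_tendsto (hf x).norm (Eventually.of_forall fun n => norm_approx_le hA n t.2 x)
  let f₀ : E →ₗ[ℂ] E :=
    { toFun := f
      map_add' := fun x y => by
        refine tendsto_nhds_unique (hf (x + y)) ?_
        simp_rw [map_add]
        exact (hf x).add (hf y)
      map_smul' := fun c x => by
        refine tendsto_nhds_unique (hf (c • x)) ?_
        simp_rw [map_smul]
        exact (hf x).const_smul c }
  exact ⟨f₀.mkContinuous 1 fun x => by rw [one_mul]; exact hb x, hb, hf⟩

/-- The contraction semigroup generated by an m-dissipative operator. -/
def semigroup (t : ℝ≥0) : E →L[ℂ] E := (exists_semigroup hA t).choose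

theorem norm_semigroup_le (t : ℝ≥0) (x : E) : ‖semigroup hA t x‖ ≤ ‖x‖ :=
  (exists_semigroup hA t).choose_spec.1 x

theorem tendsto_approx (t : ℝ≥0) (x : E) :
    Tendsto (fun n => approx hA n t x) atTop (𝓝 (semigroup hA t x)) :=
  (exists_semigroup hA t).choose_spec.2 x

/-- Uniform contractivity allows the argument to vary with `n`. This is what passes to the limit in
compositions and in `approx n s (yosida n x)`. -/
theorem tendsto_approx_of_tendsto (t : ℝ≥0) {x : ℕ → E} {y : E} (h : Tendsto x atTop (𝓝 y)) :
    Tendsto (fun n => approx hA n t (x n)) atTop (𝓝 (semigroup hA t y)) := by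
  have h1 : Tendsto (fun n => approx hA n t (x n - y)) atTop (𝓝 0) :=
    squeeze_zero_norm (fun n => norm_approx_le hA n t.2 _)
      (by simpa using (h.sub_const y).norm)
  have h2 := h1.add (tendsto_approx hA t y)
  simpa using h2

theorem semigroup_zero : semigroup hA 0 = ContinuousLinearMap.id ℂ E := by
  ext x
  refine tendsto_nhds_unique (tendsto_approx hA 0 x) ?_
  simp [approx]

theorem semigroup_add (s t : ℝ≥0) (x : E) :
    semigroup hA (s + t) x = semigroup hA s (semigroup hA t x) := by
  refine tendsto_nhds_unique (tendsto_approx hA (s + t) x) ?_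
  simp_rw [NNReal.coe_add, approx_add]
  exact tendsto_approx_of_tendsto hA s (tendsto_approx hA t x)

theorem norm_approx_sub_approx_le (n : ℕ) {s t : ℝ} (hs : 0 ≤ s) (ht : 0 ≤ t) (x : E) :
    ‖approx hA n t x - approx hA n s x‖ ≤
      ‖yosida hA (Nat.cast_add_one_pos (α := ℝ) n) x‖ * |t - s| :=
  (convex_Ici 0).norm_image_sub_le_of_norm_hasDerivWithin_le
    (fun r _ => (hasDerivAt_exp_apply (yosida hA (Nat.cast_add_one_pos (α := ℝ) n)) x
      r).hasDerivWithinAt) (fun _ hr => norm_approx_le hA n hr _) hs ht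

/-- For `x` in the domain the orbit is Lipschitz with constant `‖A x‖`, the limit of the Lipschitz
constants of the approximations. Every other orbit is a uniform limit of such orbits. -/
theorem continuous_semigroup (x : E) : Continuous fun t => semigroup hA t x := by
  have h1 : ∀ x : A.domain, Continuous fun t => semigroup hA t (x : E) := by
    intro x
    refine LipschitzWith.continuous (K := ‖A x‖₊) (LipschitzWith.of_dist_le_mul fun t s => ?_)
    rw [dist_eq_norm, NNReal.dist_eq]
    exact le_of_tendsto_of_tendsto'
      ((tendsto_approx hA t (x : E)).sub (tendsto_approx hA s (x : E))).norm
      ((tendsto_yosida hA x).norm.mul_const _)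
      fun n => norm_approx_sub_approx_le hA n s.2 t.2 x
  refine continuous_of_uniform_approx_of_continuous fun u hu => ?_
  obtain ⟨ε, hε, hu⟩ := Metric.mem_uniformity_dist.1 hu
  obtain ⟨y, hy, hxy⟩ := Metric.dense_iff.1 (dense_domain hA) x ε hε
  refine ⟨fun t => semigroup hA t y, h1 ⟨y, hxy⟩, fun t => hu ?_⟩
  rw [dist_eq_norm, ← map_sub]
  rw [Metric.mem_ball, dist_comm, dist_eq_norm] at hy
  exact (norm_semigroup_le hA t _).trans_lt hy

/-- The orbit is extended to negative times by its value at `0`, so integrals of it are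
differentiable on the whole line, including at `0`. -/
theorem continuous_semigroup_toNNReal (x : E) :
    Continuous fun s : ℝ => semigroup hA s.toNNReal x :=
  (continuous_semigroup hA x).comp continuous_real_toNNReal

theorem semigroup_sub_eq_integral (t : ℝ≥0) (x : A.domain) :
    semigroup hA t x - x = ∫ s in (0 : ℝ)..t, semigroup hA s.toNNReal (A x) := by
  refine tendsto_nhds_unique ((tendsto_approx hA t (x : E)).sub_const _) ?_
  simp_rw [approx_sub_eq_integral]
  -- The convergent sequence of Yosida approximations at `x` is bounded; `K` is the dominating
  -- constant.
  obtain ⟨K, hK⟩ := (tendsto_yosida hA x).norm.bddAbove_range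
  refine intervalIntegral.tendsto_integral_filter_of_dominated_convergence (fun _ => K) ?_ ?_ ?_ ?_
  · exact Eventually.of_forall fun n => (continuous_approx hA n _).aestronglyMeasurable
  · refine Eventually.of_forall fun n => Eventually.of_forall fun s hs => ?_
    rw [uIoc_of_le t.coe_nonneg] at hs
    exact (norm_approx_le hA n hs.1.le _).trans (hK ⟨n, rfl⟩)
  · exact intervalIntegrable_const
  · refine Eventually.of_forall fun s hs => ?_
    rw [uIoc_of_le t.coe_nonneg] at hs
    have := tendsto_approx_of_tendsto hA s.toNNReal (tendsto_yosida hA x)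
    rwa [Real.coe_toNNReal s hs.1.le] at this

theorem isContractionSemigroup : IsContractionSemigroup (semigroup hA) where
  map_zero := semigroup_zero hA
  map_add s t := ContinuousLinearMap.ext fun x => semigroup_add hA s t x
  strongly_continuous := continuous_semigroup hA
  norm_le_one t := ContinuousLinearMap.opNorm_le_bound _ zero_le_one fun x => by
    rw [one_mul]; exact norm_semigroup_le hA t x

theorem hasDerivAt_integral_semigroup (x : E) (t : ℝ) :
    HasDerivAt (fun r => ∫ s in (0 : ℝ)..r, semigroup hA s.toNNReal x)
      (semigroup hA t.toNNReal x) t :=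
  ((continuous_semigroup_toNNReal hA x).integral_hasStrictDerivAt 0 t).hasDerivAt

theorem tendsto_coe_nnreal : Tendsto (fun t : ℝ≥0 => (t : ℝ)) (𝓝[>] 0) (𝓝[>] 0) :=
  tendsto_nhdsWithin_iff.2 ⟨((NNReal.continuous_coe.tendsto 0).mono_left nhdsWithin_le_nhds),
    eventually_nhdsWithin_of_forall fun _ ht => NNReal.coe_pos.2 ht⟩

theorem tendsto_slope_semigroup (x : A.domain) :
    Tendsto (fun t : ℝ≥0 => (t : ℝ)⁻¹ • (semigroup hA t x - x)) (𝓝[>] 0) (𝓝 (A x)) := by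
  have h := (hasDerivAt_integral_semigroup hA (A x) 0).tendsto_slope_zero_right
  simp only [Real.toNNReal_zero, semigroup_zero, ContinuousLinearMap.id_apply, zero_add,
    intervalIntegral.integral_same, sub_zero] at h
  refine (h.comp tendsto_coe_nnreal).congr fun t => ?_
  rw [semigroup_sub_eq_integral]; rfl

/-- The integral formula shows that the generator extends `A`. Conversely, if the difference
quotients at `x` tend to `y`, take `x'` in the domain with `x' - A x' = x - y`. For `z = x - x'` the
quotients tend to `y - A x' = z`. Contractivity makes their real inner product with `z` nonpositive,
so `‖z‖² ≤ 0` and `x = x'`. -/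
theorem isGenerator : IsGenerator A (semigroup hA) := by
  refine fun x y => ⟨?_, fun h => ?_⟩
  · rintro ⟨hx, rfl⟩
    exact tendsto_slope_semigroup hA ⟨x, hx⟩
  obtain ⟨x', hx'⟩ := exists_sub_eq hA (x - y)
  have h1 := h.sub (tendsto_slope_semigroup hA x')
  have h2 : y - A x' = x - x' := by rw [sub_eq_sub_iff_add_eq_add] at hx' ⊢; rw [add_comm, hx']
  set z := x - x' with hz
  have h3 : Tendsto (fun t : ℝ≥0 => (inner ℂ ((t : ℝ)⁻¹ • (semigroup hA t z - z)) z).re) (𝓝[>] 0)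
      (𝓝 (inner ℂ z z).re) := by
    refine (Complex.continuous_re.tendsto _).comp (Tendsto.inner ?_ tendsto_const_nhds)
    rw [h2] at h1
    refine h1.congr fun t => ?_
    rw [← smul_sub, hz, map_sub]; congr 1; abel
  have h4 : (inner ℂ z z).re ≤ 0 := by
    have : (𝓝[>] (0 : ℝ≥0)).NeBot := inferInstance
    refine le_of_tendsto h3 (Eventually.of_forall fun t => ?_)
    have e1 : ((t : ℝ)⁻¹ • (semigroup hA t z - z) : E)
        = (((t : ℝ)⁻¹ : ℝ) : ℂ) • (semigroup hA t z - z) := rfl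
    rw [e1, inner_smul_left, Complex.conj_ofReal, Complex.re_ofReal_mul, inner_sub_left,
      Complex.sub_re]
    refine mul_nonpos_of_nonneg_of_nonpos (inv_nonneg.2 t.coe_nonneg) ?_
    have e2 : (inner ℂ (semigroup hA t z) z).re ≤ _ := re_inner_le_norm (𝕜 := ℂ) _ _
    have e3 : (inner ℂ z z : ℂ).re = ‖z‖ ^ 2 := by
      simp [inner_self_eq_norm_sq_to_K, ← Complex.ofReal_pow]
    rw [e3]
    nlinarith [mul_le_mul_of_nonneg_right (norm_semigroup_le hA t z) (norm_nonneg z)]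
  have h5 : z = 0 := by
    have e3 : (inner ℂ z z : ℂ).re = ‖z‖ ^ 2 := by
      simp [inner_self_eq_norm_sq_to_K, ← Complex.ofReal_pow]
    rw [e3] at h4
    exact norm_eq_zero.1 (by nlinarith [norm_nonneg z])
  have h6 : x = x' := sub_eq_zero.1 h5
  rw [h5, sub_eq_zero] at h2
  subst h6
  exact ⟨x'.2, h2.symm⟩

/-- The difference quotient at `T t x` is `T t` applied to the one at `x`, so it converges to `T t
(A x)`; the characterisation of the generator does the rest. -/
theorem semigroup_mem (x : A.domain) (t : ℝ≥0) :
    ∃ h : semigroup hA t x ∈ A.domain, A ⟨_, h⟩ = semigroup hA t (A x) := by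
  rw [isGenerator hA]
  refine (((semigroup hA t).continuous.tendsto _).comp (tendsto_slope_semigroup hA x)).congr
    fun s => ?_
  simp only [Function.comp_apply]
  rw [← semigroup_add, add_comm s t, semigroup_add, ← map_sub]
  exact ((semigroup hA t).restrictScalars ℝ).map_smul _ _

/-! ### Strong and weak solutions, uniqueness. -/

theorem isStrongSolution {U : C(ℝ≥0, E)} {x : E} (hU : ∀ t, U t = semigroup hA t x)
    (hx : x ∈ A.domain) : IsStrongSolution A x U := by
  have hc := continuous_semigroup_toNNReal hA (A ⟨x, hx⟩)
  have hd := hasDerivAt_integral_semigroup hA (A ⟨x, hx⟩)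
  -- On `[0, ∞)` the orbit coincides with a function that is `C¹` on all of `ℝ`, which settles the
  -- one-sided derivative at `0`.
  have he : EqOn (fun t : ℝ => U t.toNNReal)
      (fun t => x + ∫ s in (0 : ℝ)..t, semigroup hA s.toNNReal (A ⟨x, hx⟩)) (Ici 0) := by
    intro t ht
    have := semigroup_sub_eq_integral hA t.toNNReal ⟨x, hx⟩
    rw [Real.coe_toNNReal t ht] at this
    dsimp only
    rw [hU, ← this]; abel
  refine ⟨by rw [hU, semigroup_zero]; rfl, ?_, fun t => ?_, ?_, fun t => ?_⟩
  · refine ContDiffOn.congr (ContDiff.contDiffOn ?_) he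
    refine contDiff_const.add (contDiff_one_iff_deriv.2 ⟨fun t => (hd t).differentiableAt, ?_⟩)
    rw [show deriv _ = _ from funext fun t => (hd t).deriv]
    exact hc
  · rw [hU]; exact (semigroup_mem hA ⟨x, hx⟩ t).1
  · refine U.continuous.prodMk ?_
    refine (continuous_semigroup hA (A ⟨x, hx⟩)).congr fun t => ?_
    rw [← (semigroup_mem hA ⟨x, hx⟩ t).2]
    congr 2; exact (hU t).symm
  · have e := (semigroup_mem hA ⟨x, hx⟩ t).2
    have : A ⟨U t, by rw [hU]; exact (semigroup_mem hA ⟨x, hx⟩ t).1⟩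
        = semigroup hA (t : ℝ).toNNReal (A ⟨x, hx⟩) := by
      rw [Real.toNNReal_coe, ← e]; congr 2; exact hU t
    rw [this]
    exact (((hd t).const_add x).hasDerivWithinAt).congr he (he t.coe_nonneg)

theorem isWeakSolution {U : C(ℝ≥0, E)} {x : E} (hU : ∀ t, U t = semigroup hA t x) :
    IsWeakSolution A x U := by
  refine ⟨by rw [hU, semigroup_zero]; rfl, fun ψ ψ' hψ t => ?_⟩
  simp_rw [hU]
  have hint : ∀ x, IntervalIntegrable (fun s : ℝ => semigroup hA s.toNNReal x) volume 0 t :=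
    fun x => (continuous_semigroup_toNNReal hA x).intervalIntegrable _ _
  have hin : ∀ (φ x : E), ∫ s in (0 : ℝ)..t, inner ℂ φ (semigroup hA s.toNNReal x)
      = inner ℂ φ (∫ s in (0 : ℝ)..t, semigroup hA s.toNNReal x) := fun φ x =>
    (innerSL ℂ φ).intervalIntegral_comp_comm (hint x)
  rw [hin]
  -- Both sides of the weak identity depend continuously on the initial value (the time integral is
  -- `t`-Lipschitz in it), so it suffices to check it on the dense domain.
  have hcl : IsClosed {x : E | inner ℂ ψ (semigroup hA t x)
      = inner ℂ ψ x + inner ℂ ψ' (∫ s in (0 : ℝ)..t, semigroup hA s.toNNReal x)} := by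
    refine isClosed_eq (continuous_const.inner (semigroup hA t).continuous)
      ((continuous_const.inner continuous_id).add (continuous_const.inner ?_))
    refine LipschitzWith.continuous (K := t) (LipschitzWith.of_dist_le_mul fun x y => ?_)
    rw [dist_eq_norm, ← intervalIntegral.integral_sub (hint x) (hint y), dist_eq_norm]
    have := intervalIntegral.norm_integral_le_of_norm_le_const (a := (0 : ℝ)) (b := t)
      (C := ‖x - y‖) (f := fun s => semigroup hA s.toNNReal x - semigroup hA s.toNNReal y)
      fun s _ => by rw [← map_sub]; exact norm_semigroup_le hA _ _
    rw [sub_zero, abs_of_nonneg t.coe_nonneg, mul_comm] at this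
    exact this
  refine hcl.closure_subset_iff.2 (fun x hx => ?_) (dense_domain hA x)
  have e := semigroup_sub_eq_integral hA t ⟨x, hx⟩
  have h1 : ∀ s : ℝ, inner ℂ ψ' (semigroup hA s.toNNReal x)
      = inner ℂ ψ (semigroup hA s.toNNReal (A ⟨x, hx⟩)) := fun s => by
    obtain ⟨h, h'⟩ := semigroup_mem hA ⟨x, hx⟩ s.toNNReal
    rw [← h', hψ ⟨_, h⟩]
  change _ = _
  rw [← hin]
  simp_rw [h1]
  rw [hin, ← e, inner_sub_right]
  ring

/-- An m-dissipative operator agrees with its second adjoint. -/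
theorem mem_domain_of_adjoint (hA : IsMDissipative A) {x w : E}
    (h : ∀ ψ ψ' : E, (∀ x : A.domain, inner ℂ ψ (A x) = inner ℂ ψ' (x : E)) →
      inner ℂ ψ w = inner ℂ ψ' x) : ∃ hx : x ∈ A.domain, A ⟨x, hx⟩ = w := by
  obtain ⟨x', hx'⟩ := exists_sub_eq hA (x - w)
  set R := resolvent hA one_pos with hR
  have h1 : ∀ g, inner ℂ g (x - x') = 0 := by
    intro g
    -- From `R A = R - 1` on the domain, with `R = (1 - A)⁻¹`: every `R* g` lies in the domain of
    -- the adjoint, with image `R* g - g`. These test vectors already separate `x` from `x'`.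
    have hadj : ∀ y : A.domain, inner ℂ (R.adjoint g) (A y) = inner ℂ (R.adjoint g - g) (y : E) := by
      intro y
      rw [ContinuousLinearMap.adjoint_inner_left, hR, resolvent_map hA one_pos y,
        Complex.ofReal_one, one_smul, inner_sub_left, inner_sub_right,
        ContinuousLinearMap.adjoint_inner_left]
    have e1 := h _ _ hadj
    have e2 := hadj x'
    have e3 : inner ℂ (R.adjoint g) (w - A x') = inner ℂ (R.adjoint g - g) (x - x') := by
      rw [inner_sub_right, inner_sub_right, e1, e2]
    have e4 : w - A x' = x - x' := by
      rw [sub_eq_sub_iff_add_eq_add] at hx' ⊢; rw [add_comm, hx']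
    rw [e4, inner_sub_left] at e3
    exact sub_eq_self.1 e3.symm
  have h2 : x = x' := sub_eq_zero.1 (inner_self_eq_zero.1 (h1 _))
  subst h2
  exact ⟨x'.2, (sub_right_injective hx')⟩

/-- The difference `W` is only weakly a solution, but its primitive `X` is a strong one: the weak
identities say that `A X = W = X'`. As `X 0 = 0`, dissipativity gives `X = 0`, and then `W = A X =
0`. -/
theorem isWeakSolution_unique (hA : IsMDissipative A) {x : E} {U V : C(ℝ≥0, E)}
    (hU : IsWeakSolution A x U) (hV : IsWeakSolution A x V) : V = U := by
  let W : ℝ → E := fun t => V t.toNNReal - U t.toNNReal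
  have hW : Continuous W := (V.continuous.comp continuous_real_toNNReal).sub
    (U.continuous.comp continuous_real_toNNReal)
  let X : ℝ → E := fun t => ∫ s in (0 : ℝ)..t, W s
  have hX : ∀ t, HasDerivAt X (W t) t := fun t => (hW.integral_hasStrictDerivAt 0 t).hasDerivAt
  have key : ∀ t : ℝ, 0 ≤ t → ∃ h : X t ∈ A.domain, A ⟨X t, h⟩ = W t := by
    intro t ht
    refine mem_domain_of_adjoint hA fun ψ ψ' hψ => ?_
    have h1 := hU.2 ψ ψ' hψ t.toNNReal
    have h2 := hV.2 ψ ψ' hψ t.toNNReal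
    rw [Real.coe_toNNReal t ht] at h1 h2
    have h3 : ∀ Y : C(ℝ≥0, E), IntervalIntegrable (fun s : ℝ => inner ℂ ψ' (Y s.toNNReal))
        volume 0 t := fun Y => (continuous_const.inner
          (Y.continuous.comp continuous_real_toNNReal)).intervalIntegrable _ _
    have h4 : inner ℂ ψ' (X t) = ∫ s in (0 : ℝ)..t, inner ℂ ψ' (W s) :=
      ((innerSL ℂ ψ').intervalIntegral_comp_comm (hW.intervalIntegrable 0 t)).symm
    rw [h4]
    simp only [W, inner_sub_right]
    rw [h1, h2, intervalIntegral.integral_sub (h3 V) (h3 U)]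
    ring
  have h0 : ∀ t : ℝ, 0 ≤ t → X t = 0 := by
    intro t ht
    have := norm_le_norm_zero_of_dissipative (fun s _ => hX s) (fun s hs => by
      obtain ⟨h, h'⟩ := key s hs
      rw [← h']; exact hA.1 ⟨X s, h⟩) ht
    simpa [X] using this
  ext t
  have h1 := (key t t.coe_nonneg)
  obtain ⟨h, h'⟩ := h1
  have h2 : (⟨X t, h⟩ : A.domain) = 0 := Subtype.ext (h0 t t.coe_nonneg)
  rw [h2, LinearPMap.map_zero] at h'
  simp only [W, Real.toNNReal_coe] at h'
  exact sub_eq_zero.1 h'.symm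

theorem exists_contractionSemigroup (hA : IsMDissipative A) :
    ∃ T : ℝ≥0 → E →L[ℂ] E,
      IsContractionSemigroup T ∧ IsGenerator A T ∧
      ∀ U₀ : E, ∃ U : C(ℝ≥0, E),
        (∀ t, U t = T t U₀) ∧
        IsWeakSolution A U₀ U ∧
        (∀ V : C(ℝ≥0, E), IsWeakSolution A U₀ V → V = U) ∧
        (U₀ ∈ A.domain → IsStrongSolution A U₀ U) :=
  ⟨semigroup hA, isContractionSemigroup hA, isGenerator hA, fun x =>
    ⟨⟨fun t => semigroup hA t x, continuous_semigroup hA x⟩, fun _ => rfl,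
      isWeakSolution hA fun _ => rfl,
      fun _ hV => isWeakSolution_unique hA (isWeakSolution hA fun _ => rfl) hV,
      isStrongSolution hA fun _ => rfl⟩⟩

end IsMDissipative
end Abstract

/-! ### The primitive operator on `L²(a, b)` -/

section Interval

variable {a b : ℝ}

/-- Fubini on the triangle `t < x`. -/
theorem integral_primitive_mul {f g : ℝ → ℂ} (hf : Integrable f (volume.restrict (Ioo a b)))
    (hg : Integrable g (volume.restrict (Ioo a b))) :
    ∫ x in Ioo a b, (∫ t in a..x, f t) * g x
      = ∫ x in Ioo a b, f x * ((∫ t in Ioo a b, g t) - ∫ t in a..x, g t) := by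
  have hprod := hg.mul_prod hf
  have hms : MeasurableSet {p : ℝ × ℝ | p.2 < p.1} := measurableSet_lt measurable_snd measurable_fst
  have hswap := integral_integral_swap
    (f := fun x t => ({p : ℝ × ℝ | p.2 < p.1}).indicator (fun z => g z.1 * f z.2) (x, t))
    (hprod.indicator hms)
  have hL : ∀ x ∈ Ioo a b, ∫ t in Ioo a b,
      ({p : ℝ × ℝ | p.2 < p.1}).indicator (fun z => g z.1 * f z.2) (x, t)
      = (∫ t in a..x, f t) * g x := by
    intro x hx
    have : ∀ t, ({p : ℝ × ℝ | p.2 < p.1}).indicator (fun z => g z.1 * f z.2) (x, t)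
        = (Iio x).indicator (fun t => g x * f t) t := by
      intro t; simp [indicator]
    simp_rw [this]
    rw [setIntegral_indicator measurableSet_Iio, integral_const_mul,
      intervalIntegral.integral_of_le hx.1.le, integral_Ioc_eq_integral_Ioo, mul_comm]
    congr 3
    ext t; simp only [mem_inter_iff, mem_Ioo, mem_Iio]
    exact ⟨fun h => ⟨h.1.1, h.2⟩, fun h => ⟨⟨h.1, h.2.trans hx.2⟩, h.2⟩⟩
  have hR : ∀ t ∈ Ioo a b, ∫ x in Ioo a b,
      ({p : ℝ × ℝ | p.2 < p.1}).indicator (fun z => g z.1 * f z.2) (x, t)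
      = f t * ((∫ x in Ioo a b, g x) - ∫ x in a..t, g x) := by
    intro t ht
    have : ∀ x, ({p : ℝ × ℝ | p.2 < p.1}).indicator (fun z => g z.1 * f z.2) (x, t)
        = (Ioi t).indicator (fun x => g x * f t) x := by
      intro x; simp [indicator]
    simp_rw [this]
    have hs : Ioo a b ∩ Ioi t = Ioo t b := by
      ext x; simp only [mem_inter_iff, mem_Ioo, mem_Ioi]
      exact ⟨fun h => ⟨h.2, h.1.2⟩, fun h => ⟨⟨ht.1.trans h.1, h.2⟩, h.1⟩⟩
    have hab : a ≤ b := (ht.1.trans ht.2).le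
    have hI : IntervalIntegrable g volume a b := by
      rw [intervalIntegrable_iff_integrableOn_Ioo_of_le hab]; exact hg
    have h1 : IntervalIntegrable g volume a t :=
      hI.mono_set (by rw [uIcc_of_le hab, uIcc_of_le ht.1.le]; exact Icc_subset_Icc_right ht.2.le)
    have h2 : IntervalIntegrable g volume t b :=
      hI.mono_set (by rw [uIcc_of_le hab, uIcc_of_le ht.2.le]; exact Icc_subset_Icc_left ht.1.le)
    rw [setIntegral_indicator measurableSet_Ioi, integral_mul_const, hs, mul_comm,
      ← integral_Ioc_eq_integral_Ioo, ← intervalIntegral.integral_of_le ht.2.le,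
      ← integral_Ioc_eq_integral_Ioo (x := a), ← intervalIntegral.integral_of_le hab,
      ← intervalIntegral.integral_add_adjacent_intervals h1 h2]
    ring
  rwa [setIntegral_congr_fun measurableSet_Ioo hL, setIntegral_congr_fun measurableSet_Ioo hR]
    at hswap

theorem continuousOn_primitive {f : ℝ → ℂ} (hf : Integrable f (volume.restrict (Ioo a b))) :
    ContinuousOn (fun x => ∫ t in a..x, f t) (Icc a b) := by
  rcases le_or_gt a b with hab | hab
  · have hI : IntegrableOn f (Icc a b) := by
      rw [integrableOn_Icc_iff_integrableOn_Ioo]; exact hf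
    have := intervalIntegral.continuousOn_primitive_interval (f := f) (a := a) (b := b) (μ := volume)
      (by rwa [uIcc_of_le hab])
    rwa [uIcc_of_le hab] at this
  · simp [Icc_eq_empty_of_lt hab]

theorem memLp_of_continuousOn {F : ℝ → ℂ} (hF : ContinuousOn F (Icc a b)) :
    MemLp F 2 (volume.restrict (Ioo a b)) := by
  obtain ⟨C, hC⟩ := isCompact_Icc.exists_bound_of_continuousOn hF
  refine MemLp.of_bound ((hF.mono Ioo_subset_Icc_self).aestronglyMeasurable measurableSet_Ioo) C ?_
  exact (ae_restrict_iff' measurableSet_Ioo).2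
    (Eventually.of_forall fun x hx => hC x (Ioo_subset_Icc_self hx))

variable (a b) in
/-- The constant function `1` in `L²(a, b)`. -/
def one : L2 a b := Lp.const 2 _ 1

theorem coeFn_one : (one a b : ℝ → ℂ) =ᵐ[volume.restrict (Ioo a b)] fun _ => 1 :=
  Lp.coeFn_const 2 _ (1 : ℂ)

theorem inner_one (f : L2 a b) : inner ℂ (one a b) f = ∫ x in Ioo a b, f x := by
  rw [L2.inner_def]
  refine integral_congr_ae ?_
  filter_upwards [coeFn_one (a := a) (b := b)] with x hx
  simp [hx]

theorem norm_primitive_le (f : L2 a b) {x : ℝ} (hx : x ∈ Icc a b) :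
    ‖∫ t in a..x, f t‖ ≤ (volume.restrict (Ioo a b)).real univ ^ (1 / 2 : ℝ) * ‖f‖ := by
  -- The primitive at `x` is the inner product with the indicator of `(a, x)`, so Cauchy–Schwarz
  -- bounds it uniformly in `x`.
  have h1 : ∫ t in a..x, f t = inner ℂ (indicatorConstLp 2 (μ := volume.restrict (Ioo a b))
      (measurableSet_Ioo (a := a) (b := x)) (measure_ne_top _ _) (1 : ℂ)) f := by
    rw [L2.inner_indicatorConstLp_one, Measure.restrict_restrict measurableSet_Ioo,
      intervalIntegral.integral_of_le hx.1, integral_Ioc_eq_integral_Ioo,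
      inter_eq_left.2 (Ioo_subset_Ioo_right hx.2)]
  rw [h1]
  refine (norm_inner_le_norm _ _).trans ?_
  gcongr
  refine norm_indicatorConstLp_le.trans ?_
  rw [norm_one, one_mul]
  simp only [ENNReal.toReal_ofNat]
  gcongr
  exact measure_ne_top _ _
  exact subset_univ _

/-- The function `x ↦ ∫_a^x f` as an element of `L²(a, b)`. -/
def primFun (f : L2 a b) : L2 a b :=
  (memLp_of_continuousOn (continuousOn_primitive f.integrable)).toLp _

theorem coeFn_primFun (f : L2 a b) :
    primFun f =ᵐ[volume.restrict (Ioo a b)] fun x => ∫ t in a..x, f t :=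
  MemLp.coeFn_toLp _

theorem intervalIntegrable_L2 (f : L2 a b) {x y : ℝ} (hx : x ∈ Icc a b) (hy : y ∈ Icc a b) :
    IntervalIntegrable f volume x y := by
  have hab := hx.1.trans hx.2
  have hI : IntervalIntegrable f volume a b := by
    rw [intervalIntegrable_iff_integrableOn_Ioo_of_le hab]; exact f.integrable
  refine hI.mono_set ?_
  rw [uIcc_of_le hab]
  exact uIcc_subset_Icc hx hy

theorem primitive_congr {f g : ℝ → ℂ} (h : f =ᵐ[volume.restrict (Ioo a b)] g) {x y : ℝ}
    (hx : x ∈ Icc a b) (hy : y ∈ Icc a b) : ∫ t in x..y, f t = ∫ t in x..y, g t := by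
  refine intervalIntegral.integral_congr_ae ?_
  rw [restrict_Ioo_eq_restrict_Icc] at h
  filter_upwards [(ae_restrict_iff' measurableSet_Icc).1 h] with t ht ht'
  exact ht (uIcc_subset_Icc hx hy (uIoc_subset_uIcc ht'))

/-- The operator `f ↦ ∫_a^x f` on `L²(a, b)`. -/
def prim : L2 a b →L[ℂ] L2 a b :=
  LinearMap.mkContinuous
    { toFun := primFun
      map_add' := fun f g => by
        refine Lp.ext ?_
        filter_upwards [coeFn_primFun (f + g), Lp.coeFn_add (primFun f) (primFun g),
          coeFn_primFun f, coeFn_primFun g, ae_restrict_mem measurableSet_Ioo] with x h1 h2 h3 h4 hx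
        have hx' := Ioo_subset_Icc_self hx
        have ha := left_mem_Icc.2 (hx'.1.trans hx'.2)
        rw [h1, h2, Pi.add_apply, h3, h4, primitive_congr (Lp.coeFn_add f g) ha hx',
          ← intervalIntegral.integral_add (intervalIntegrable_L2 f ha hx')
            (intervalIntegrable_L2 g ha hx')]
        rfl
      map_smul' := fun c f => by
        refine Lp.ext ?_
        filter_upwards [coeFn_primFun (c • f), Lp.coeFn_smul c (primFun f),
          coeFn_primFun f, ae_restrict_mem measurableSet_Ioo] with x h1 h2 h3 hx
        have hx' := Ioo_subset_Icc_self hx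
        have ha := left_mem_Icc.2 (hx'.1.trans hx'.2)
        rw [h1, RingHom.id_apply, h2, Pi.smul_apply, h3, primitive_congr (Lp.coeFn_smul c f) ha hx',
          ← intervalIntegral.integral_smul]
        rfl }
    (measureUnivNNReal (volume.restrict (Ioo a b)) ^ (2 : ENNReal).toReal⁻¹ *
      (volume.restrict (Ioo a b)).real univ ^ (1 / 2 : ℝ))
    fun f => by
      rw [mul_assoc]
      refine Lp.norm_le_of_ae_bound (by positivity) ?_
      filter_upwards [coeFn_primFun f, ae_restrict_mem measurableSet_Ioo] with x h1 hx
      change ‖primFun f x‖ ≤ _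
      rw [h1]
      exact norm_primitive_le f (Ioo_subset_Icc_self hx)

theorem coeFn_prim (f : L2 a b) :
    prim f =ᵐ[volume.restrict (Ioo a b)] fun x => ∫ t in a..x, f t :=
  coeFn_primFun f

theorem coeFn_smul_one_add_prim (c : ℂ) (f : L2 a b) :
    (c • one a b + prim f : L2 a b) =ᵐ[volume.restrict (Ioo a b)] fun x => c + ∫ t in a..x, f t := by
  filter_upwards [Lp.coeFn_add (c • one a b) (prim f), Lp.coeFn_smul c (one a b), coeFn_prim f,
    coeFn_one (a := a) (b := b)] with x h1 h2 h3 h4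
  rw [h1, Pi.add_apply, h2, Pi.smul_apply, h3, h4, smul_eq_mul, mul_one]

/-- The adjoint of integration from the left end is integration up to the right end, `g ↦ ∫_x^b g`,
written here as total integral minus primitive. -/
theorem inner_prim_left (f g : L2 a b) :
    inner ℂ (prim f) g = inner ℂ f (inner ℂ (one a b) g • one a b - prim g) := by
  have h := integral_primitive_mul (f := fun x => starRingEnd ℂ (f x))
    (Complex.conjCLE.toContinuousLinearMap.integrable_comp f.integrable) g.integrable
  rw [L2.inner_def, L2.inner_def]
  refine Eq.trans (integral_congr_ae ?_) (h.trans (integral_congr_ae ?_))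
  · filter_upwards [coeFn_prim f] with x hx
    rw [hx, RCLike.inner_apply, mul_comm, ← intervalIntegral.intervalIntegral_conj]
  · filter_upwards [Lp.coeFn_sub (inner ℂ (one a b) g • one a b) (prim g),
      Lp.coeFn_smul (inner ℂ (one a b) g) (one a b), coeFn_prim g,
      coeFn_one (a := a) (b := b)] with x h1 h2 h3 h4
    rw [h1, Pi.sub_apply, h2, Pi.smul_apply, h3, h4, inner_one, RCLike.inner_apply]
    simp [mul_comm]

theorem hasWeakDeriv_smul_one_add_prim (c : ℂ) (g : L2 a b) :
    HasWeakDeriv (c • one a b + prim g) g := by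
  intro φ hφ
  have e : ∫ x in Ioo a b, deriv φ x • (c • one a b + prim g : L2 a b) x
      = ∫ x in Ioo a b, (deriv φ x • c + deriv φ x • ∫ t in a..x, g t) := by
    refine integral_congr_ae ?_
    filter_upwards [coeFn_smul_one_add_prim c g] with x hx
    rw [hx, smul_add]
  have h1 := integrable_smul_test (a := a) (b := b) hφ.deriv_continuous hφ.2.1.deriv
    (integrable_const c)
  have h2 := integrable_smul_test (a := a) (b := b) hφ.deriv_continuous hφ.2.1.deriv
    ((memLp_of_continuousOn (continuousOn_primitive g.integrable)).integrable (by norm_num))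
  have h3 : ∫ x in Ioo a b, deriv φ x = 0 := by
    rw [setIntegral_test (tsupport_deriv_subset.trans hφ.2.2)]
    exact integral_eq_zero_of_hasDerivAt_of_integrable
      (fun x => (hφ.1.differentiable (by simp) x).hasDerivAt)
      (hφ.deriv_continuous.integrable_of_hasCompactSupport hφ.2.1.deriv)
      (hφ.1.continuous.integrable_of_hasCompactSupport hφ.2.1)
  rw [e, integral_add h1 h2, integral_smul_const, h3, zero_smul, zero_add,
    weakDeriv_primitive g.integrable hφ]

theorem isContRep_smul_one_add_prim (c : ℂ) (g : L2 a b) :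
    IsContRep (c • one a b + prim g) (fun x => c + ∫ t in a..x, g t) :=
  ⟨continuousOn_const.add (continuousOn_primitive g.integrable), coeFn_smul_one_add_prim c g⟩

/-- The difference of the two sides has weak derivative zero and vanishes at `a`. This normal form
reduces calculus in `H¹` to algebra with `one` and `prim`. -/
theorem eq_smul_one_add_prim (hab : a < b) {f : L2 a b} (hf : f ∈ H1 a b) :
    f = trace f a • one a b + prim (wderiv f) := by
  have hw := hasWeakDeriv_smul_one_add_prim (trace f a) (wderiv f)
  set g := trace f a • one a b + prim (wderiv f) with hg
  have hgm : g ∈ H1 a b := ⟨_, hw⟩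
  have ha := left_mem_Icc.2 hab.le
  have hn : (-1 : ℂ) • g ∈ H1 a b := Submodule.smul_mem _ _ hgm
  have h := eq_zero_of_wderiv_eq_zero hab (f := f + (-1 : ℂ) • g) (add_mem hf hn)
    (by rw [wderiv_add hf hn, wderiv_smul _ hgm, hw.wderiv_eq]; simp) ha
    (by
      rw [trace_add hab hf hn ha, trace_smul hab _ hgm ha,
        (isContRep_smul_one_add_prim (trace f a) (wderiv f)).trace_eq hab ha]
      simp)
  rw [neg_one_smul, ← sub_eq_add_neg, sub_eq_zero] at h
  exact h

theorem trace_right_eq (hab : a < b) {f : L2 a b} (hf : f ∈ H1 a b) :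
    trace f b = trace f a + inner ℂ (one a b) (wderiv f) := by
  have hb := right_mem_Icc.2 hab.le
  have h : trace f b = trace (trace f a • one a b + prim (wderiv f)) b :=
    congrArg (fun h => trace h b) (eq_smul_one_add_prim hab hf)
  rw [h, (isContRep_smul_one_add_prim _ _).trace_eq hab hb, inner_one,
    intervalIntegral.integral_of_le hab.le, integral_Ioc_eq_integral_Ioo]

/-- Integration by parts in `H¹(a, b)`. -/
theorem inner_wderiv_add_inner_wderiv (hab : a < b) {f g : L2 a b} (hf : f ∈ H1 a b)
    (hg : g ∈ H1 a b) :
    inner ℂ (wderiv f) g + inner ℂ f (wderiv g)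
      = starRingEnd ℂ (trace f b) * trace g b - starRingEnd ℂ (trace f a) * trace g a := by
  have h1 : inner ℂ (wderiv f) g = inner ℂ (wderiv f) (trace g a • one a b + prim (wderiv g)) :=
    congrArg _ (eq_smul_one_add_prim hab hg)
  have h2 : inner ℂ f (wderiv g) = inner ℂ (trace f a • one a b + prim (wderiv f)) (wderiv g) :=
    congrArg (fun h => inner ℂ h (wderiv g)) (eq_smul_one_add_prim hab hf)
  rw [h1, h2, trace_right_eq hab hf, trace_right_eq hab hg, inner_add_left, inner_prim_left,
    inner_add_right, inner_sub_right, inner_smul_right, inner_smul_right, inner_smul_left, map_add,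
    inner_conj_symm]
  ring

/-! ### Restriction to a subinterval -/

variable {c d : ℝ}

/-- The restriction of `f ∈ L²(a, b)` to `(c, d) ⊆ (a, b)`. -/
def restr (h : Ioo c d ⊆ Ioo a b) (f : L2 a b) : L2 c d :=
  ((Lp.memLp f).mono_measure (Measure.restrict_mono h le_rfl)).toLp _

theorem coeFn_restr (h : Ioo c d ⊆ Ioo a b) (f : L2 a b) :
    restr h f =ᵐ[volume.restrict (Ioo c d)] f :=
  MemLp.coeFn_toLp _

theorem ae_restrict_of_subset {h : Ioo c d ⊆ Ioo a b} {p : ℝ → Prop}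
    (hp : ∀ᵐ x ∂(volume.restrict (Ioo a b)), p x) : ∀ᵐ x ∂(volume.restrict (Ioo c d)), p x :=
  ae_mono (Measure.restrict_mono h le_rfl) hp

/-- Splitting the integral at `c` moves the base point from `a` to `c`. -/
theorem restr_smul_one_add_prim (hcd : c < d) (h : Ioo c d ⊆ Ioo a b) (k : ℂ) (g : L2 a b) :
    restr h (k • one a b + prim g)
      = (k + ∫ t in a..c, g t) • one c d + prim (restr h g) := by
  have hIcc : Icc c d ⊆ Icc a b := by
    have := closure_mono h
    rw [closure_Ioo hcd.ne] at this
    exact this.trans (closure_minimal Ioo_subset_Icc_self isClosed_Icc)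
  refine Lp.ext ?_
  filter_upwards [coeFn_restr h (k • one a b + prim g),
    ae_restrict_of_subset (h := h) (coeFn_smul_one_add_prim k g),
    coeFn_smul_one_add_prim (k + ∫ t in a..c, g t) (restr h g),
    ae_restrict_mem measurableSet_Ioo] with x h1 h2 h3 hx
  have hx' := Ioo_subset_Icc_self hx
  have hc := hIcc (left_mem_Icc.2 hcd.le)
  have ha := left_mem_Icc.2 (hc.1.trans hc.2)
  rw [h1, h2, h3, primitive_congr (coeFn_restr h g) (left_mem_Icc.2 hcd.le) hx', add_assoc,
    intervalIntegral.integral_add_adjacent_intervals (intervalIntegrable_L2 g ha hc)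
      (intervalIntegrable_L2 g hc (hIcc hx'))]

theorem hasWeakDeriv_restr (hcd : c < d) (h : Ioo c d ⊆ Ioo a b) (k : ℂ) (g : L2 a b) :
    HasWeakDeriv (restr h (k • one a b + prim g)) (restr h g) := by
  rw [restr_smul_one_add_prim hcd]
  exact hasWeakDeriv_smul_one_add_prim _ _

theorem trace_restr (hcd : c < d) (h : Ioo c d ⊆ Ioo a b) (k : ℂ) (g : L2 a b) {x : ℝ}
    (hx : x ∈ Icc c d) : trace (restr h (k • one a b + prim g)) x = k + ∫ t in a..x, g t := by
  have hIcc : Icc c d ⊆ Icc a b := by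
    have := closure_mono h
    rw [closure_Ioo hcd.ne] at this
    exact this.trans (closure_minimal Ioo_subset_Icc_self isClosed_Icc)
  have : IsContRep (restr h (k • one a b + prim g)) (fun x => k + ∫ t in a..x, g t) :=
    ⟨(isContRep_smul_one_add_prim k g).1.mono hIcc, (coeFn_restr h _).trans
      (ae_restrict_of_subset (h := h) (isContRep_smul_one_add_prim k g).2)⟩
  exact this.trace_eq hcd hx

theorem restr_add (h : Ioo c d ⊆ Ioo a b) (f g : L2 a b) :
    restr h (f + g) = restr h f + restr h g := by
  refine Lp.ext ?_
  filter_upwards [coeFn_restr h (f + g), coeFn_restr h f, coeFn_restr h g,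
    Lp.coeFn_add (restr h f) (restr h g),
    ae_restrict_of_subset (h := h) (Lp.coeFn_add f g)] with x h1 h2 h3 h4 h5
  rw [h1, h4, h5, Pi.add_apply, Pi.add_apply, h2, h3]

theorem restr_smul (h : Ioo c d ⊆ Ioo a b) (k : ℂ) (f : L2 a b) :
    restr h (k • f) = k • restr h f := by
  refine Lp.ext ?_
  filter_upwards [coeFn_restr h (k • f), coeFn_restr h f, Lp.coeFn_smul k (restr h f),
    ae_restrict_of_subset (h := h) (Lp.coeFn_smul k f)] with x h1 h2 h3 h4
  rw [h1, h3, h4, Pi.smul_apply, Pi.smul_apply, h2]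

theorem restr_sub (h : Ioo c d ⊆ Ioo a b) (f g : L2 a b) :
    restr h (f - g) = restr h f - restr h g := by
  rw [sub_eq_add_neg, ← neg_one_smul ℂ g, restr_add, restr_smul, neg_one_smul, ← sub_eq_add_neg]

/-! ### Multiplication operators -/

/-- Multiplication by a bounded real function. -/
theorem exists_mulOp (m : ℝ → ℝ) (hm : Measurable m) {C : ℝ} (hC : ∀ x, |m x| ≤ C) :
    ∃ M : L2 a b →L[ℂ] L2 a b,
      ∀ f, M f =ᵐ[volume.restrict (Ioo a b)] fun x => (m x : ℂ) * f x := by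
  have hb : ∀ (f : ℝ → ℂ) x, ‖(m x : ℂ) * f x‖ ≤ C * ‖f x‖ := fun f x => by
    rw [norm_mul, Complex.norm_real]
    exact mul_le_mul_of_nonneg_right (hC x) (norm_nonneg _)
  have hmem : ∀ f : L2 a b, MemLp (fun x => (m x : ℂ) * f x) 2 (volume.restrict (Ioo a b)) :=
    fun f => (Lp.memLp f).of_le_mul
      ((Complex.measurable_ofReal.comp hm).aestronglyMeasurable.mul (Lp.aestronglyMeasurable f))
      (Eventually.of_forall (hb f))
  refine ⟨LinearMap.mkContinuous
    { toFun := fun f => (hmem f).toLp _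
      map_add' := fun f g => ?_
      map_smul' := fun c f => ?_ } C fun f => ?_, fun f => (hmem f).coeFn_toLp⟩
  · refine Lp.ext ?_
    filter_upwards [(hmem (f + g)).coeFn_toLp, (hmem f).coeFn_toLp, (hmem g).coeFn_toLp,
      Lp.coeFn_add f g, Lp.coeFn_add ((hmem f).toLp _) ((hmem g).toLp _)] with x h1 h2 h3 h4 h5
    rw [h1, h5, h4, Pi.add_apply, Pi.add_apply, h2, h3, mul_add]
  · refine Lp.ext ?_
    filter_upwards [(hmem (c • f)).coeFn_toLp, (hmem f).coeFn_toLp,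
      Lp.coeFn_smul c f, Lp.coeFn_smul c ((hmem f).toLp _)] with x h1 h2 h3 h4
    rw [h1, RingHom.id_apply, h4, h3, Pi.smul_apply, Pi.smul_apply, h2, smul_eq_mul, smul_eq_mul]
    ring
  · refine Lp.norm_le_mul_norm_of_ae_le_mul ?_
    filter_upwards [(hmem f).coeFn_toLp] with x hx
    change ‖(hmem f).toLp _ x‖ ≤ _
    rw [hx]
    exact hb f x

theorem le_re_inner_mul {m : ℝ → ℝ} {M : L2 a b →L[ℂ] L2 a b}
    (hM : ∀ f, M f =ᵐ[volume.restrict (Ioo a b)] fun x => (m x : ℂ) * f x) {k : ℝ}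
    (hk : ∀ x, k ≤ m x) (f : L2 a b) : k * ‖f‖ ^ 2 ≤ (inner ℂ (M f) f).re := by
  have h1 : k * ‖f‖ ^ 2 = (inner ℂ ((k : ℂ) • f) f).re := by
    rw [inner_smul_left, Complex.conj_ofReal, Complex.re_ofReal_mul, inner_self_eq_norm_sq_to_K]
    simp [← Complex.ofReal_pow]
  rw [h1, ← sub_nonneg, ← Complex.sub_re, ← inner_sub_left, L2.inner_def]
  have h2 := integral_re (𝕜 := ℂ) (L2.integrable_inner (𝕜 := ℂ) (M f - (k : ℂ) • f) f)
  change 0 ≤ RCLike.re (K := ℂ) _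
  rw [← h2]
  refine integral_nonneg_of_ae ?_
  filter_upwards [hM f, Lp.coeFn_sub (M f) ((k : ℂ) • f), Lp.coeFn_smul (k : ℂ) f] with x e1 e2 e3
  rw [e2, Pi.sub_apply, e1, e3, Pi.smul_apply, smul_eq_mul, ← sub_mul, ← Complex.ofReal_sub,
    ← smul_eq_mul, inner_smul_left, Complex.conj_ofReal]
  change 0 ≤ (_ : ℂ).re
  rw [Complex.re_ofReal_mul]
  exact mul_nonneg (sub_nonneg.2 (hk x)) (inner_self_nonneg (𝕜 := ℂ) (x := f x))

/-- The Lax–Milgram theorem, for a bounded operator whose numerical range has real part bounded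
below. -/
theorem exists_eq_of_coercive {H : Type*} [NormedAddCommGroup H] [InnerProductSpace ℂ H]
    [CompleteSpace H] (M : H →L[ℂ] H) {k : ℝ} (hk : 0 < k)
    (h : ∀ x, k * ‖x‖ ^ 2 ≤ (inner ℂ (M x) x).re) (f : H) : ∃ x, M x = f := by
  have hu := ContinuousLinearMap.isUnit_of_forall_le_norm_inner_map M (c := ⟨k, hk.le⟩) hk
    fun x => by
      rw [mul_comm]
      exact (h x).trans (Complex.re_le_norm _)
  exact ((ContinuousLinearMap.isUnit_iff_bijective).1 hu).2 f

end Interval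

/-! ### The transport equation and the equation for the strain. -/

section Solve

variable {a b : ℝ}

theorem adjoint_prim (g : L2 a b) :
    (prim : L2 a b →L[ℂ] L2 a b).adjoint g = inner ℂ (one a b) g • one a b - prim g :=
  ext_inner_left ℂ fun v => by rw [ContinuousLinearMap.adjoint_inner_right, inner_prim_left]

/-- Since `prim` plus its adjoint is the rank-one operator `⟨1, ·⟩ 1`, twice this real part is `|∫
f|²`. -/
theorem re_inner_prim_self (f : L2 a b) : 0 ≤ (inner ℂ (prim f) f).re := by
  have h := inner_prim_left f f
  rw [inner_sub_right, inner_smul_right, eq_sub_iff_add_eq] at h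
  have h1 := congrArg Complex.re h
  have h2 : (inner ℂ f (prim f)).re = (inner ℂ (prim f) f).re := inner_re_symm (𝕜 := ℂ) _ _
  have h3 : (inner ℂ (one a b) f * inner ℂ f (one a b)).re = ‖inner ℂ (one a b) f‖ ^ 2 := by
    rw [← inner_conj_symm f, Complex.mul_conj, Complex.ofReal_re, Complex.normSq_eq_norm_sq]
  rw [Complex.add_re, h2, h3] at h1
  nlinarith [sq_nonneg ‖inner ℂ (one a b) f‖]

/-- The initial value problem `f' + k f = g`, `f(a) = c`. -/
theorem exists_hasWeakDeriv_sub_smul (hab : a < b) {k : ℝ} (hk : 0 < k) (c : ℂ) (g : L2 a b) :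
    ∃ f : L2 a b, HasWeakDeriv f (g - (k : ℂ) • f) ∧ trace f a = c := by
  -- The problem is solved in integrated form `f + k prim f = c + prim g`, whose operator is
  -- coercive with constant `1`.
  obtain ⟨f, hf⟩ := exists_eq_of_coercive
    (ContinuousLinearMap.id ℂ (L2 a b) + (k : ℂ) • prim) one_pos (fun x => by
      have h1 : (inner ℂ x x).re = ‖x‖ ^ 2 := by
        simp [inner_self_eq_norm_sq_to_K, ← Complex.ofReal_pow]
      change _ ≤ (inner ℂ (x + (k : ℂ) • prim x) x).re
      rw [inner_add_left, inner_smul_left, Complex.conj_ofReal, Complex.add_re, h1,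
        Complex.re_ofReal_mul, one_mul]
      have := mul_nonneg hk.le (re_inner_prim_self x)
      linarith) (c • one a b + prim g)
  have hf' : f = c • one a b + prim (g - (k : ℂ) • f) := by
    rw [map_sub, map_smul, ← add_sub_assoc, ← hf]
    change f = f + (k : ℂ) • prim f - _
    abel
  refine ⟨f, ?_, ?_⟩
  · have := hasWeakDeriv_smul_one_add_prim c (g - (k : ℂ) • f)
    rwa [← hf'] at this
  · have := (isContRep_smul_one_add_prim c (g - (k : ℂ) • f)).trace_eq hab (left_mem_Icc.2 hab.le)
    rw [← hf'] at this
    simpa using this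

/-- Integration by parts gives `|f(b)|² - |f(a)|² = -2 k ‖f‖²`. -/
theorem norm_trace_right_le (hab : a < b) {k : ℝ} (hk : 0 < k) {f : L2 a b}
    (hf : HasWeakDeriv f (-((k : ℂ) • f))) : ‖trace f b‖ ≤ ‖trace f a‖ := by
  have h := inner_wderiv_add_inner_wderiv hab (f := f) (g := f) ⟨_, hf⟩ ⟨_, hf⟩
  rw [hf.wderiv_eq, inner_neg_left, inner_neg_right, inner_smul_left, inner_smul_right,
    Complex.conj_ofReal, Complex.conj_mul', Complex.conj_mul'] at h
  have h1 := congrArg Complex.re h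
  have h2 : (inner ℂ f f).re = ‖f‖ ^ 2 := by
    simp [inner_self_eq_norm_sq_to_K, ← Complex.ofReal_pow]
  simp only [Complex.add_re, Complex.sub_re, Complex.neg_re, Complex.ofReal_re,
    Complex.re_ofReal_mul, h2, ← Complex.ofReal_pow] at h1
  refine le_of_sq_le_sq ?_ (norm_nonneg _)
  nlinarith [mul_nonneg hk.le (sq_nonneg ‖f‖)]

/-- The resolvent problem of the transmission system, as an equation for the strain `p` on the
whole interval; `q` is the strain rate and `K p + D q` is the stress. -/
theorem exists_stress {mK mD : ℝ → ℝ} {K D : L2 a b →L[ℂ] L2 a b}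
    (hK : ∀ f, K f =ᵐ[volume.restrict (Ioo a b)] fun x => (mK x : ℂ) * f x)
    (hD : ∀ f, D f =ᵐ[volume.restrict (Ioo a b)] fun x => (mD x : ℂ) * f x)
    {κ : ℝ} (hκ : 0 < κ) (hmK : ∀ x, κ ≤ mK x) (hmD : ∀ x, 0 ≤ mD x) {r : ℝ} (hr : 0 < r)
    {c : ℂ} (hc : 0 ≤ c.re) (d : ℂ) (p₀ g : L2 a b) :
    ∃ p q s : L2 a b, q = (r : ℂ) • p - p₀ ∧ s = (r : ℂ) • prim q - g ∧
      K p + D q = (-(c * inner ℂ (one a b) q + d) - inner ℂ (one a b) s) • one a b + prim s := by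
  set ℓ : L2 a b →L[ℂ] ℂ := innerSL ℂ (one a b) with hℓ
  set S : L2 a b →L[ℂ] L2 a b := prim with hS
  -- Substituting `q` and `s` into the stress equation and using that `s ↦ ⟨1, s⟩ 1 - prim s` is the
  -- adjoint of `prim` leaves `M p` equal to the data. In the real part, the terms in `D`, `S* S`
  -- and the rank-one operator are nonnegative, the last one because `Re c ≥ 0`, so `K` alone yields
  -- coercivity with constant `κ`.
  set M : L2 a b →L[ℂ] L2 a b := K + (r : ℂ) • D + ((r ^ 2 : ℝ) : ℂ) • (S.adjoint ∘L S)
    + (c * r) • ℓ.smulRight (one a b) with hM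
  have hMa : ∀ x, M x = K x + (r : ℂ) • D x + ((r ^ 2 : ℝ) : ℂ) • S.adjoint (S x)
    + (c * r) • (ℓ x • one a b) := fun x => rfl
  obtain ⟨p, hp⟩ := exists_eq_of_coercive M hκ (fun x => by
    have h1 := le_re_inner_mul hK hmK x
    have h2 := le_re_inner_mul hD hmD x
    have h3 : (inner ℂ (S.adjoint (S x)) x).re = ‖S x‖ ^ 2 := by
      rw [ContinuousLinearMap.adjoint_inner_left]
      simp [inner_self_eq_norm_sq_to_K, ← Complex.ofReal_pow]
    have h4 : inner ℂ ((c * r) • (ℓ x • one a b)) x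
        = starRingEnd ℂ c * ((r * ‖ℓ x‖ ^ 2 : ℝ) : ℂ) := by
      rw [inner_smul_left, inner_smul_left, map_mul, Complex.conj_ofReal]
      change _ * (starRingEnd ℂ (ℓ x) * ℓ x) = _
      rw [mul_comm (starRingEnd ℂ (ℓ x)), Complex.mul_conj, Complex.normSq_eq_norm_sq]
      push_cast; ring
    rw [hMa, inner_add_left, inner_add_left, inner_add_left, h4, inner_smul_left, inner_smul_left,
      Complex.conj_ofReal, Complex.conj_ofReal, Complex.add_re, Complex.add_re, Complex.add_re,
      Complex.re_ofReal_mul, Complex.re_ofReal_mul, Complex.re_mul_ofReal, Complex.conj_re, h3]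
    have e1 := mul_nonneg hr.le (by simpa using h2)
    have e2 : 0 ≤ r ^ 2 * ‖S x‖ ^ 2 := by positivity
    have e3 : 0 ≤ c.re * (r * ‖ℓ x‖ ^ 2) := by positivity
    linarith)
    (D p₀ + (c * ℓ p₀) • one a b - d • one a b + (r : ℂ) • S.adjoint (S p₀) + S.adjoint g)
  refine ⟨p, _, _, rfl, rfl, ?_⟩
  set q := (r : ℂ) • p - p₀ with hq
  set s := (r : ℂ) • S q - g with hs
  have e1 : (-(c * inner ℂ (one a b) q + d) - inner ℂ (one a b) s) • one a b + S s
      = -((c * ℓ q + d) • one a b) - S.adjoint s := by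
    rw [adjoint_prim, sub_smul, neg_smul]
    change _ = -((c * inner ℂ (one a b) q + d) • one a b) - _
    abel
  rw [e1, hs, hq]
  rw [hMa] at hp
  simp only [map_sub, map_smul] at hp ⊢
  push_cast at hp
  simp only [smul_eq_mul] at hp ⊢
  linear_combination (norm := module) hp

end Solve

theorem wderiv_sub {a b : ℝ} {f g : L2 a b} (hf : f ∈ H1 a b) (hg : g ∈ H1 a b) :
    wderiv (f - g) = wderiv f - wderiv g := by
  rw [sub_eq_add_neg, ← neg_one_smul ℂ g, wderiv_add hf (Submodule.smul_mem _ _ hg),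
    wderiv_smul _ hg, neg_one_smul, ← sub_eq_add_neg]

/-! ### Gluing along `α` and `β`, primitives on the whole string. -/

namespace System

variable {P : System}

/-- By definiteness of the energy form the strains determine the displacements, so equations in
`ℍ¹_L` may be checked after differentiation. -/
theorem Energy.ext_wderiv {U V : P.Energy} (h1 : wderiv U.u = wderiv V.u)
    (h2 : wderiv U.v = wderiv V.v) (h3 : wderiv U.w = wderiv V.w) (h4 : U.y = V.y)
    (h5 : U.z = V.z) (h6 : U.φ = V.φ) (h7 : U.η = V.η) : U = V := by
  refine sub_eq_zero.1 (eq_zero_of_energyInner _ ?_)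
  have e1 : wderiv (U - V).u = 0 := (wderiv_sub U.u_mem V.u_mem).trans (sub_eq_zero.2 h1)
  have e2 : wderiv (U - V).v = 0 := (wderiv_sub U.v_mem V.v_mem).trans (sub_eq_zero.2 h2)
  have e3 : wderiv (U - V).w = 0 := (wderiv_sub U.w_mem V.w_mem).trans (sub_eq_zero.2 h3)
  have e4 : (U - V).y = 0 := sub_eq_zero.2 h4
  have e5 : (U - V).z = 0 := sub_eq_zero.2 h5
  have e6 : (U - V).φ = 0 := sub_eq_zero.2 h6
  have e7 : (U - V).η = 0 := sub_eq_zero.2 h7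
  simp [energyInner, e1, e2, e3, e4, e5, e6, e7]

theorem Ioo_subset₁ (P : System) : Ioo 0 P.α ⊆ Ioo 0 P.L :=
  Ioo_subset_Ioo_right (P.α_lt_β.trans P.β_lt_L).le

theorem Ioo_subset₂ (P : System) : Ioo P.α P.β ⊆ Ioo 0 P.L :=
  Ioo_subset_Ioo P.α_pos.le P.β_lt_L.le

theorem Ioo_subset₃ (P : System) : Ioo P.β P.L ⊆ Ioo 0 P.L :=
  Ioo_subset_Ioo_left (P.α_pos.trans P.α_lt_β).le

/-- The element of `L²(0, L)` with given restrictions to `(0, α)`, `(α, β)` and `(β, L)`. -/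
theorem exists_glue (f : L2 0 P.α) (g : L2 P.α P.β) (h : L2 P.β P.L) :
    ∃ p : L2 0 P.L, restr P.Ioo_subset₁ p = f ∧ restr P.Ioo_subset₂ p = g ∧
      restr P.Ioo_subset₃ p = h := by
  have l1 := P.α_lt_β
  have l2 := P.β_lt_L
  have hf := (memLp_indicator_iff_restrict measurableSet_Ioo).2 (Lp.memLp f)
  have hg := (memLp_indicator_iff_restrict measurableSet_Ioo).2 (Lp.memLp g)
  have hh := (memLp_indicator_iff_restrict measurableSet_Ioo).2 (Lp.memLp h)
  have hm := ((hf.add hg).add hh).restrict (Ioo 0 P.L)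
  refine ⟨hm.toLp _, ?_, ?_, ?_⟩
  all_goals
    refine Lp.ext ?_
    first
    | filter_upwards [coeFn_restr P.Ioo_subset₁ (hm.toLp _),
        ae_restrict_of_subset (h := P.Ioo_subset₁) hm.coeFn_toLp,
        ae_restrict_mem measurableSet_Ioo] with x h1 h2 hx
      have n2 : x ∉ Ioo P.α P.β := fun k => by linarith [hx.2, k.1]
      have n3 : x ∉ Ioo P.β P.L := fun k => by linarith [hx.2, k.1]
      rw [h1, h2]; simp [hx, n2, n3]
    | filter_upwards [coeFn_restr P.Ioo_subset₂ (hm.toLp _),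
        ae_restrict_of_subset (h := P.Ioo_subset₂) hm.coeFn_toLp,
        ae_restrict_mem measurableSet_Ioo] with x h1 h2 hx
      have n1 : x ∉ Ioo 0 P.α := fun k => by linarith [hx.1, k.2]
      have n3 : x ∉ Ioo P.β P.L := fun k => by linarith [hx.2, k.1]
      rw [h1, h2]; simp [hx, n1, n3]
    | filter_upwards [coeFn_restr P.Ioo_subset₃ (hm.toLp _),
        ae_restrict_of_subset (h := P.Ioo_subset₃) hm.coeFn_toLp,
        ae_restrict_mem measurableSet_Ioo] with x h1 h2 hx
      have n1 : x ∉ Ioo 0 P.α := fun k => by linarith [hx.1, k.2]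
      have n2 : x ∉ Ioo P.α P.β := fun k => by linarith [hx.1, k.2]
      rw [h1, h2]; simp [hx, n1, n2]

theorem hasWeakDeriv_restr_prim {a b c d : ℝ} (hcd : c < d) (h : Ioo c d ⊆ Ioo a b) (p : L2 a b) :
    HasWeakDeriv (restr h (prim p)) (restr h p) := by
  simpa using hasWeakDeriv_restr hcd h 0 p

theorem trace_restr_prim {a b c d : ℝ} (hcd : c < d) (h : Ioo c d ⊆ Ioo a b) (p : L2 a b) {x : ℝ}
    (hx : x ∈ Icc c d) : trace (restr h (prim p)) x = ∫ t in a..x, p t := by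
  simpa using trace_restr hcd h 0 p hx

/-- The triple of restrictions of `x ↦ ∫_0^x p`. -/
def triple (p : L2 0 P.L) : P.LL2 :=
  (restr P.Ioo_subset₁ (prim p), restr P.Ioo_subset₂ (prim p), restr P.Ioo_subset₃ (prim p))

/-- The three pieces come from one continuous function vanishing at `0`, so their boundary values
match. -/
theorem triple_mem (p : L2 0 P.L) : triple p ∈ P.HH1L := by
  have h1 := P.α_pos
  have h2 := P.α_lt_β
  have h3 := P.β_lt_L
  refine ⟨⟨_, hasWeakDeriv_restr_prim h1 P.Ioo_subset₁ p⟩, ⟨_, hasWeakDeriv_restr_prim h2 P.Ioo_subset₂ p⟩,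
    ⟨_, hasWeakDeriv_restr_prim h3 P.Ioo_subset₃ p⟩, ?_, ?_, ?_⟩
  · exact (trace_restr_prim h1 P.Ioo_subset₁ p (left_mem_Icc.2 h1.le)).trans intervalIntegral.integral_same
  · exact (trace_restr_prim h1 P.Ioo_subset₁ p (right_mem_Icc.2 h1.le)).trans
      (trace_restr_prim h2 P.Ioo_subset₂ p (left_mem_Icc.2 h2.le)).symm
  · exact (trace_restr_prim h2 P.Ioo_subset₂ p (right_mem_Icc.2 h2.le)).trans
      (trace_restr_prim h3 P.Ioo_subset₃ p (left_mem_Icc.2 h3.le)).symm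

/-! ### Completeness of the energy space -/

theorem norm_sq_energy (U : P.Energy) : ‖U‖ ^ 2 =
    P.κ₁ * ‖wderiv U.u‖ ^ 2 + P.κ₂ * ‖wderiv U.v‖ ^ 2 + P.κ₃ * ‖wderiv U.w‖ ^ 2
    + ‖U.y‖ ^ 2 + ‖U.z‖ ^ 2 + ‖U.φ‖ ^ 2 + P.τ * ‖U.η‖ ^ 2 := by
  rw [← energyInner_self_re, ← inner_eq, inner_self_eq_norm_sq_to_K]
  simp [← Complex.ofReal_pow]

variable (P) in
/-- The energy space is linearly homeomorphic to a product of `L²` spaces. -/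
def coords : P.Energy →ₗ[ℂ] P.LL2 × P.LL2 × L2 0 1 where
  toFun U := ((wderiv U.u, wderiv U.v, wderiv U.w), (U.y, U.z, U.φ), U.η)
  map_add' U V := Prod.ext (Prod.ext (wderiv_add U.u_mem V.u_mem)
    (Prod.ext (wderiv_add U.v_mem V.v_mem) (wderiv_add U.w_mem V.w_mem))) rfl
  map_smul' c U := Prod.ext (Prod.ext (wderiv_smul c U.u_mem)
    (Prod.ext (wderiv_smul c U.v_mem) (wderiv_smul c U.w_mem))) rfl

/-- Surjectivity: glue the three strains and integrate from `0`; the result satisfies all conditions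
of `ℍ¹_L`. -/
theorem coords_bijective : Function.Bijective (coords P) := by
  constructor
  · intro U V h
    simp only [coords, LinearMap.coe_mk, AddHom.coe_mk, Prod.mk.injEq] at h
    obtain ⟨⟨h1, h2, h3⟩, ⟨h4, h5, h6⟩, h7⟩ := h
    exact Energy.ext_wderiv h1 h2 h3 h4 h5 h6 h7
  · rintro ⟨⟨f, g, h⟩, x⟩
    obtain ⟨p, h1, h2, h3⟩ := exists_glue f g h
    refine ⟨(⟨triple p, triple_mem p⟩, x), Prod.ext (Prod.ext ?_ (Prod.ext ?_ ?_)) rfl⟩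
    · exact (hasWeakDeriv_restr_prim P.α_pos _ p).wderiv_eq.trans h1
    · exact (hasWeakDeriv_restr_prim P.α_lt_β _ p).wderiv_eq.trans h2
    · exact (hasWeakDeriv_restr_prim P.β_lt_L _ p).wderiv_eq.trans h3

theorem norm_coords_le (U : P.Energy) :
    ‖coords P U‖ ≤ √(P.κ₁⁻¹ + P.κ₂⁻¹ + P.κ₃⁻¹ + 1 + P.τ⁻¹) * ‖U‖ := by
  have k1 := P.κ₁_pos
  have k2 := P.κ₂_pos
  have k3 := P.κ₃_pos
  have k4 := P.τ_pos
  have hU := norm_sq_energy U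
  -- `C` dominates the inverse of each weight of the energy, the `1` serving the unweighted
  -- velocities. The product carries the maximum norm, so each component is estimated separately.
  set C := P.κ₁⁻¹ + P.κ₂⁻¹ + P.κ₃⁻¹ + 1 + P.τ⁻¹ with hC
  have i1 := inv_pos.2 k1
  have i2 := inv_pos.2 k2
  have i3 := inv_pos.2 k3
  have i4 := inv_pos.2 k4
  have n1 : 0 ≤ P.κ₁ * ‖wderiv U.u‖ ^ 2 := by positivity
  have n2 : 0 ≤ P.κ₂ * ‖wderiv U.v‖ ^ 2 := by positivity
  have n3 : 0 ≤ P.κ₃ * ‖wderiv U.w‖ ^ 2 := by positivity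
  have n4 : 0 ≤ ‖U.y‖ ^ 2 := by positivity
  have n5 : 0 ≤ ‖U.z‖ ^ 2 := by positivity
  have n6 : 0 ≤ ‖U.φ‖ ^ 2 := by positivity
  have n7 : 0 ≤ P.τ * ‖U.η‖ ^ 2 := by positivity
  have aux : ∀ {κ x : ℝ}, 0 < κ → 0 ≤ x → κ⁻¹ ≤ C → κ * x ^ 2 ≤ ‖U‖ ^ 2 → x ≤ √C * ‖U‖ := by
    intro κ x hκ hx h1 h2
    refine le_of_sq_le_sq ?_ (by positivity)
    rw [mul_pow, Real.sq_sqrt (by positivity)]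
    calc x ^ 2 = κ⁻¹ * (κ * x ^ 2) := by rw [inv_mul_cancel_left₀ hκ.ne']
      _ ≤ C * ‖U‖ ^ 2 := by gcongr
  have one_le : (1 : ℝ)⁻¹ ≤ C := by rw [inv_one]; linarith
  refine norm_prod_le_iff.2 ⟨norm_prod_le_iff.2 ⟨?_, norm_prod_le_iff.2 ⟨?_, ?_⟩⟩,
    norm_prod_le_iff.2 ⟨norm_prod_le_iff.2 ⟨?_, norm_prod_le_iff.2 ⟨?_, ?_⟩⟩, ?_⟩⟩
  · exact aux (x := ‖wderiv U.u‖) k1 (norm_nonneg _) (by linarith) (by linarith)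
  · exact aux (x := ‖wderiv U.v‖) k2 (norm_nonneg _) (by linarith) (by linarith)
  · exact aux (x := ‖wderiv U.w‖) k3 (norm_nonneg _) (by linarith) (by linarith)
  · exact aux (x := ‖U.y‖) one_pos (norm_nonneg _) one_le (by linarith)
  · exact aux (x := ‖U.z‖) one_pos (norm_nonneg _) one_le (by linarith)
  · exact aux (x := ‖U.φ‖) one_pos (norm_nonneg _) one_le (by linarith)
  · exact aux (x := ‖U.η‖) k4 (norm_nonneg _) (by linarith) (by linarith)

theorem norm_le_coords (U : P.Energy) :
    ‖U‖ ≤ √(P.κ₁ + P.κ₂ + P.κ₃ + 3 + P.τ) * ‖coords P U‖ := by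
  have k1 := P.κ₁_pos
  have k2 := P.κ₂_pos
  have k3 := P.κ₃_pos
  have k4 := P.τ_pos
  obtain ⟨h1, h2⟩ := norm_prod_le_iff.1 (le_refl ‖coords P U‖)
  obtain ⟨h3, h4⟩ := norm_prod_le_iff.1 h1
  obtain ⟨h5, h6⟩ := norm_prod_le_iff.1 h4
  obtain ⟨h7, h8⟩ := norm_prod_le_iff.1 h2
  obtain ⟨h9, h10⟩ := norm_prod_le_iff.1 h7
  obtain ⟨h11, h12⟩ := norm_prod_le_iff.1 h10
  refine le_of_sq_le_sq ?_ (by positivity)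
  rw [mul_pow, Real.sq_sqrt (by positivity), norm_sq_energy]
  set n := ‖coords P U‖
  change ‖wderiv U.u‖ ≤ n at h3
  change ‖wderiv U.v‖ ≤ n at h5
  change ‖wderiv U.w‖ ≤ n at h6
  change ‖U.y‖ ≤ n at h9
  change ‖U.z‖ ≤ n at h11
  change ‖U.φ‖ ≤ n at h12
  change ‖U.η‖ ≤ n at h8
  calc _ ≤ P.κ₁ * n ^ 2 + P.κ₂ * n ^ 2 + P.κ₃ * n ^ 2 + n ^ 2 + n ^ 2 + n ^ 2 + P.τ * n ^ 2 := by
        gcongr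
    _ = _ := by ring

instance : CompleteSpace P.Energy := by
  have e := (LinearEquiv.ofBijective (coords P) coords_bijective).toContinuousLinearEquivOfBounds
    _ _ norm_coords_le (fun x => by
      have h := norm_le_coords ((LinearEquiv.ofBijective (coords P) coords_bijective).symm x)
      have h' : coords P ((LinearEquiv.ofBijective (coords P) coords_bijective).symm x) = x :=
        LinearEquiv.apply_symm_apply (LinearEquiv.ofBijective (coords P) coords_bijective) x
      rwa [h'] at h)
  exact (completeSpace_congr (e := e.toEquiv) e.isUniformEmbedding).2 inferInstance

/-! ### Consequences of hypothesis (H). -/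

theorem HypH.sq_lt (hP : P.HypH) : (P.κ₃ * P.δ₂) ^ 2 < 2 * P.κ₃ * P.δ₃ - 1 := by
  obtain ⟨h1, -, -, -, h2, h3⟩ := hP
  have h4 : 0 ≤ 2 * P.κ₃ * P.δ₃ - 1 := by
    rw [div_lt_iff₀ (by positivity)] at h2; linarith
  have h5 : |P.κ₃ * P.δ₂| < √(2 * P.κ₃ * P.δ₃ - 1) := by
    rw [abs_mul, abs_of_pos h1]
    calc P.κ₃ * |P.δ₂| < P.κ₃ * (1 / P.κ₃ * √(2 * P.κ₃ * P.δ₃ - 1)) := by gcongr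
      _ = _ := by field_simp
  have h6 := pow_lt_pow_left₀ h5 (abs_nonneg _) two_ne_zero
  rwa [sq_abs, Real.sq_sqrt h4] at h6

/-- `(κ₃ δ₂)² < 2 κ₃ δ₃ - 1 ≤ (κ₃ δ₃)²`, the last step being `(κ₃ δ₃ - 1)² ≥ 0`. -/
theorem HypH.abs_le (hP : P.HypH) : |P.δ₂| ≤ P.δ₃ := by
  have h1 := hP.sq_lt
  obtain ⟨h2, -, h3, -⟩ := hP
  have h4 : (P.κ₃ * P.δ₂) ^ 2 ≤ (P.κ₃ * P.δ₃) ^ 2 := by nlinarith [sq_nonneg (P.κ₃ * P.δ₃ - 1)]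
  have h5 := sq_le_sq.1 h4
  rw [abs_mul, abs_mul, abs_of_pos h2, abs_of_pos h3] at h5
  exact le_of_mul_le_mul_left h5 h2

/-! ### Dissipativity -/

theorem isDissipative_opA (hP : P.HypH) : IsDissipative P.opA := by
  rintro ⟨U, ⟨a1, a2, a3, a4, a5, a6, a7, a8, a9⟩⟩
  obtain ⟨m1, m2, m3, m4, m5, m6⟩ := a1
  dsimp only at m1 m2 m3 m4 m5 m6
  have l1 := P.α_pos
  have l2 := P.α_lt_β
  have l3 := P.β_lt_L
  set q := (P.κ₂ : ℂ) • U.v + (P.δ₁ : ℂ) • U.z with hq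
  have hq' : wderiv q = (P.κ₂ : ℂ) • wderiv U.v + (P.δ₁ : ℂ) • wderiv U.z := by
    rw [hq, wderiv_add (Submodule.smul_mem _ _ U.v_mem) (Submodule.smul_mem _ _ m2),
      wderiv_smul _ U.v_mem, wderiv_smul _ m2]
  have b1 := inner_wderiv_add_inner_wderiv l1 a3.2 m1
  have b2 := inner_wderiv_add_inner_wderiv l2 a4.2 m2
  have b3 := inner_wderiv_add_inner_wderiv l3 a5.2 m3
  have b4 := inner_wderiv_add_inner_wderiv one_pos a2 a2
  -- The boundary and transmission conditions are inserted, so that the terms at `α` and `β` cancel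
  -- once `b1`, `b2`, `b3` are added with weights `κ₁`, `1`, `κ₃`.
  rw [m4, mul_zero, sub_zero, m5] at b1
  rw [a6, a7, m6] at b2
  rw [a8, a9] at b3
  change (energyInner _ U).re ≤ 0
  have hE : energyInner (P.opA ⟨U, ⟨m1, m2, m3, m4, m5, m6⟩, a2, a3, a4, a5, a6, a7, a8, a9⟩) U
      = P.κ₁ * inner ℂ (wderiv U.y) (wderiv U.u) + P.κ₂ * inner ℂ (wderiv U.z) (wderiv U.v)
      + P.κ₃ * inner ℂ (wderiv U.φ) (wderiv U.w)
      + inner ℂ ((P.κ₁ : ℂ) • wderiv (wderiv U.u)) U.y + inner ℂ (wderiv (wderiv q)) U.z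
      + inner ℂ ((P.κ₃ : ℂ) • wderiv (wderiv U.w)) U.φ
      + P.τ * inner ℂ ((-(P.τ : ℂ)⁻¹) • wderiv U.η) U.η := rfl
  rw [hE, inner_smul_left, inner_smul_left, inner_smul_left, map_neg, map_inv₀,
    Complex.conj_ofReal, Complex.conj_ofReal, Complex.conj_ofReal,
    neg_mul, mul_neg, mul_inv_cancel_left₀ (by exact_mod_cast P.τ_pos.ne')]
  have s : ∀ {a b : ℝ} (f g : L2 a b), (inner ℂ f g).re = (inner ℂ g f).re :=
    fun f g => inner_re_symm (𝕜 := ℂ) f g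
  have hz : (inner ℂ (wderiv q) (wderiv U.z)).re
      = P.κ₂ * (inner ℂ (wderiv U.v) (wderiv U.z)).re + P.δ₁ * ‖wderiv U.z‖ ^ 2 := by
    rw [hq', inner_add_left, inner_smul_left, inner_smul_left, Complex.conj_ofReal,
      Complex.conj_ofReal, Complex.add_re, Complex.re_ofReal_mul, Complex.re_ofReal_mul,
      inner_self_eq_norm_sq_to_K]
    simp [← Complex.ofReal_pow]
  have c1 := congrArg Complex.re b1
  have c2 := congrArg Complex.re b2
  have c3 := congrArg Complex.re b3
  have c4 := congrArg Complex.re b4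
  rw [Complex.add_re] at c1 c2 c3 c4
  rw [hz] at c2
  rw [s U.η] at c4
  simp only [Complex.add_re, Complex.neg_re, Complex.re_ofReal_mul, s (wderiv U.y),
    s (wderiv U.z), s (wderiv U.φ)]
  simp only [map_mul, map_sub, map_neg, Complex.conj_ofReal, Complex.sub_re, Complex.mul_re,
    Complex.conj_re, Complex.conj_im, Complex.ofReal_re, Complex.ofReal_im, Complex.neg_re,
    Complex.sub_im, Complex.mul_im, Complex.neg_im] at c1 c2 c3 c4
  have hs := hP.sq_lt
  obtain ⟨h1, h2, -⟩ := hP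
  set e0 := trace U.η 0
  set e1 := trace U.η 1
  have n1 : 0 ≤ P.δ₁ * ‖wderiv U.z‖ ^ 2 := by positivity
  have n2 : 0 ≤ (2 * P.κ₃ * P.δ₃ - 1 - (P.κ₃ * P.δ₂) ^ 2) * (e0.re ^ 2 + e0.im ^ 2) :=
    mul_nonneg (sub_nonneg.2 hs.le) (by positivity)
  have n3 := sq_nonneg (e1.re + P.κ₃ * P.δ₂ * e0.re)
  have n4 := sq_nonneg (e1.im + P.κ₃ * P.δ₂ * e0.im)
  -- The real part equals `-δ₁ ‖z_x‖² - ½ (2 κ₃ δ₃ - 1 - κ₃² δ₂²) |η(0)|² - ½ |η(1) + κ₃ δ₂ η(0)|²`.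
  linear_combination P.κ₁ * c1 + c2 + P.κ₃ * c3 - (1 / 2) * c4 + n1 + (1 / 2) * n2 + (1 / 2) * n3
    + (1 / 2) * n4

/-! ### The range condition -/

/-- The function with values `k₁`, `k₂`, `k₃` on `(0, α)`, `(α, β)`, `(β, L)`. -/
def stepFun (P : System) (k₁ k₂ k₃ : ℝ) (x : ℝ) : ℝ :=
  if x < P.α then k₁ else if x < P.β then k₂ else k₃

theorem exists_stepOp (P : System) (k₁ k₂ k₃ : ℝ) : ∃ M : L2 0 P.L →L[ℂ] L2 0 P.L,
    (∀ f, M f =ᵐ[volume.restrict (Ioo 0 P.L)] fun x => (P.stepFun k₁ k₂ k₃ x : ℂ) * f x) ∧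
    ∀ f, restr P.Ioo_subset₁ (M f) = (k₁ : ℂ) • restr P.Ioo_subset₁ f ∧
      restr P.Ioo_subset₂ (M f) = (k₂ : ℂ) • restr P.Ioo_subset₂ f ∧
      restr P.Ioo_subset₃ (M f) = (k₃ : ℂ) • restr P.Ioo_subset₃ f := by
  have l2 := P.α_lt_β
  obtain ⟨M, hM⟩ := exists_mulOp (a := 0) (b := P.L) (P.stepFun k₁ k₂ k₃)
    (Measurable.ite measurableSet_Iio measurable_const
      (Measurable.ite measurableSet_Iio measurable_const measurable_const))
    (C := |k₁| + |k₂| + |k₃|) (fun x => by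
      have := abs_nonneg k₁
      have := abs_nonneg k₂
      have := abs_nonneg k₃
      unfold stepFun
      split_ifs <;> linarith)
  have key : ∀ {c d : ℝ} (h : Ioo c d ⊆ Ioo 0 P.L) (k : ℝ)
      (_ : ∀ x ∈ Ioo c d, P.stepFun k₁ k₂ k₃ x = k) (f : L2 0 P.L),
      restr h (M f) = (k : ℂ) • restr h f := by
    intro c d h k hk f
    refine Lp.ext ?_
    filter_upwards [coeFn_restr h (M f), coeFn_restr h f, ae_restrict_of_subset (h := h) (hM f),
      Lp.coeFn_smul (k : ℂ) (restr h f), ae_restrict_mem measurableSet_Ioo] with x e1 e2 e3 e4 hx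
    rw [e1, e3, e4, Pi.smul_apply, e2, hk x hx, smul_eq_mul]
  refine ⟨M, hM, fun f => ⟨key _ _ (fun x hx => ?_) f, key _ _ (fun x hx => ?_) f,
    key _ _ (fun x hx => ?_) f⟩⟩
  · rw [stepFun, if_pos hx.2]
  · rw [stepFun, if_neg (not_lt.2 hx.1.le), if_pos hx.2]
  · rw [stepFun, if_neg (not_lt.2 (l2.le.trans hx.1.le)), if_neg (not_lt.2 hx.1.le)]

theorem smul_sub_opA_surjective (hP : P.HypH) {r : ℝ} (hr : 0 < r) (F : P.Energy) :
    ∃ x : P.opA.domain, (r : ℂ) • (x : P.Energy) - P.opA x = F := by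
  have l1 := P.α_pos
  have l2 := P.α_lt_β
  have l3 := P.β_lt_L
  have k1 := P.κ₁_pos
  have k2 := P.κ₂_pos
  have k3 := P.κ₃_pos
  have ht := P.τ_pos
  have hab := hP.abs_le
  have hδ₁ := hP.2.1
  have nz : ∀ {x : ℝ}, 0 < x → (x : ℂ) ≠ 0 := fun h => by exact_mod_cast h.ne'
  have hrt : 0 < r * P.τ := mul_pos hr ht
  -- the transport equation: homogeneous solution `e` and particular solution `h`
  obtain ⟨e, he, he0⟩ := exists_hasWeakDeriv_sub_smul (a := 0) (b := 1) one_pos hrt 1 0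
  rw [zero_sub] at he
  have he1 := norm_trace_right_le one_pos hrt he
  rw [he0, norm_one] at he1
  obtain ⟨h, hh, hh0⟩ := exists_hasWeakDeriv_sub_smul (a := 0) (b := 1) one_pos hrt 0
    ((P.τ : ℂ) • F.η)
  obtain ⟨K, hK, hK'⟩ := exists_stepOp P P.κ₁ P.κ₂ P.κ₃
  obtain ⟨D, hD, hD'⟩ := exists_stepOp P 0 P.δ₁ 0
  obtain ⟨p₀, p1, p2, p3⟩ := exists_glue (wderiv F.u) (wderiv F.v) (wderiv F.w)
  obtain ⟨g, g1, g2, g3⟩ := exists_glue F.y F.z F.φ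
  -- With `η = η(0) e + h`, the feedback law becomes `κ₃ w_x(L) = -(c η(0) + d)` with this `c` and
  -- `d = κ₃ δ₂ h(1)`. Its real part is nonnegative since `|e(1)| ≤ 1` and `|δ₂| ≤ δ₃`.
  have hc : 0 ≤ ((P.κ₃ : ℂ) * (P.δ₃ + P.δ₂ * trace e 1)).re := by
    rw [Complex.re_ofReal_mul, Complex.add_re, Complex.re_ofReal_mul, Complex.ofReal_re]
    refine mul_nonneg k3.le ?_
    have h1 : |P.δ₂ * (trace e 1).re| ≤ |P.δ₂| * 1 := by
      rw [abs_mul]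
      gcongr
      exact (Complex.abs_re_le_norm _).trans he1
    linarith [neg_abs_le (P.δ₂ * (trace e 1).re)]
  obtain ⟨p, q, s, hq, hs, hσ⟩ := exists_stress hK hD (κ := min P.κ₁ (min P.κ₂ P.κ₃))
    (by positivity)
    (fun x => by
      unfold stepFun
      split_ifs
      · exact min_le_left _ _
      · exact (min_le_right _ _).trans (min_le_left _ _)
      · exact (min_le_right _ _).trans (min_le_right _ _))
    (fun x => by unfold stepFun; split_ifs <;> linarith) hr hc
    (P.κ₃ * P.δ₂ * trace h 1) p₀ g
  -- `C` is the stress at `0`, chosen so that the stress at `L` satisfies the feedback law; `η₀`,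
  -- the integral of the strain rate, is the velocity at `L`.
  set C := -((P.κ₃ : ℂ) * (P.δ₃ + P.δ₂ * trace e 1) * inner ℂ (one 0 P.L) q
    + P.κ₃ * P.δ₂ * trace h 1) - inner ℂ (one 0 P.L) s with hC
  set η₀ : ℂ := inner ℂ (one 0 P.L) q with hη₀
  set σ : L2 0 P.L := K p + D q with hσ'
  set η : L2 0 1 := η₀ • e + h with hη
  -- the stress on the three intervals
  have σ1 : restr P.Ioo_subset₁ σ = (P.κ₁ : ℂ) • restr P.Ioo_subset₁ p := by
    rw [hσ', restr_add, (hK' p).1, (hD' q).1]; simp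
  have σ2 : restr P.Ioo_subset₂ σ
      = (P.κ₂ : ℂ) • restr P.Ioo_subset₂ p + (P.δ₁ : ℂ) • restr P.Ioo_subset₂ q := by
    rw [hσ', restr_add, (hK' p).2.1, (hD' q).2.1]
  have σ3 : restr P.Ioo_subset₃ σ = (P.κ₃ : ℂ) • restr P.Ioo_subset₃ p := by
    rw [hσ', restr_add, (hK' p).2.2, (hD' q).2.2]; simp
  have d1 := hasWeakDeriv_restr l1 P.Ioo_subset₁ C s
  have d2 := hasWeakDeriv_restr l2 P.Ioo_subset₂ C s
  have d3 := hasWeakDeriv_restr l3 P.Ioo_subset₃ C s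
  have t1 := trace_restr l1 P.Ioo_subset₁ C s (right_mem_Icc.2 l1.le)
  have t2 := trace_restr l2 P.Ioo_subset₂ C s (left_mem_Icc.2 l2.le)
  have t3 := trace_restr l2 P.Ioo_subset₂ C s (right_mem_Icc.2 l2.le)
  have t4 := trace_restr l3 P.Ioo_subset₃ C s (left_mem_Icc.2 l3.le)
  have t5 := trace_restr l3 P.Ioo_subset₃ C s (right_mem_Icc.2 l3.le)
  -- The stress is a single `H¹` function on `(0, L)`, so its one-sided values at `α` and `β` agree;
  -- these are the flux conditions.
  rw [← hσ] at d1 d2 d3 t1 t2 t3 t4 t5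
  have hpL : ∀ f : L2 0 P.L, ∫ t in (0 : ℝ)..P.L, f t = inner ℂ (one 0 P.L) f := fun f => by
    rw [inner_one, intervalIntegral.integral_of_le ((l1.trans l2).trans l3).le,
      integral_Ioc_eq_integral_Ioo]
  rw [hpL] at t5
  -- the strain on the outer intervals
  have ρ1 : restr P.Ioo_subset₁ p = (P.κ₁ : ℂ)⁻¹ • restr P.Ioo_subset₁ σ := by
    rw [σ1, inv_smul_smul₀ (nz k1)]
  have ρ3 : restr P.Ioo_subset₃ p = (P.κ₃ : ℂ)⁻¹ • restr P.Ioo_subset₃ σ := by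
    rw [σ3, inv_smul_smul₀ (nz k3)]
  have hσm1 : restr P.Ioo_subset₁ σ ∈ H1 0 P.α := ⟨_, d1⟩
  have hσm2 : restr P.Ioo_subset₂ σ ∈ H1 P.α P.β := ⟨_, d2⟩
  have hσm3 : restr P.Ioo_subset₃ σ ∈ H1 P.β P.L := ⟨_, d3⟩
  have hem : e ∈ H1 0 1 := ⟨_, he⟩
  have hhm : h ∈ H1 0 1 := ⟨_, hh⟩
  have hηm : η ∈ H1 0 1 := add_mem (Submodule.smul_mem _ _ hem) hhm
  have hη0 : trace η 0 = η₀ := by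
    rw [hη, trace_add one_pos (Submodule.smul_mem _ _ hem) hhm (by simp),
      trace_smul one_pos _ hem (by simp), he0, hh0, mul_one, add_zero]
  have hη1 : trace η 1 = η₀ * trace e 1 + trace h 1 := by
    rw [hη, trace_add one_pos (Submodule.smul_mem _ _ hem) hhm (by simp),
      trace_smul one_pos _ hem (by simp)]
  have hηd : wderiv η = (P.τ : ℂ) • F.η - ((r * P.τ : ℝ) : ℂ) • η := by
    rw [hη, wderiv_add (Submodule.smul_mem _ _ hem) hhm, wderiv_smul _ hem, he.wderiv_eq,
      hh.wderiv_eq]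
    module
  -- the solution
  let U : P.Energy := (⟨triple p, triple_mem p⟩, triple q, η)
  have u1 : wderiv U.u = restr P.Ioo_subset₁ p := (hasWeakDeriv_restr_prim l1 _ p).wderiv_eq
  have u2 : wderiv U.v = restr P.Ioo_subset₂ p := (hasWeakDeriv_restr_prim l2 _ p).wderiv_eq
  have u3 : wderiv U.w = restr P.Ioo_subset₃ p := (hasWeakDeriv_restr_prim l3 _ p).wderiv_eq
  obtain ⟨v1, v2, v3, -⟩ := triple_mem q
  have w1 : wderiv U.y = restr P.Ioo_subset₁ q := (hasWeakDeriv_restr_prim l1 _ q).wderiv_eq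
  have w2 : wderiv U.z = restr P.Ioo_subset₂ q := (hasWeakDeriv_restr_prim l2 _ q).wderiv_eq
  have w3 : wderiv U.φ = restr P.Ioo_subset₃ q := (hasWeakDeriv_restr_prim l3 _ q).wderiv_eq
  change U.y ∈ H1 0 P.α at v1
  change U.z ∈ H1 P.α P.β at v2
  change U.φ ∈ H1 P.β P.L at v3
  have x2 : wderiv ((P.κ₂ : ℂ) • U.v + (P.δ₁ : ℂ) • U.z) = restr P.Ioo_subset₂ σ := by
    rw [wderiv_add (Submodule.smul_mem _ _ U.v_mem) (Submodule.smul_mem _ _ v2),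
      wderiv_smul _ U.v_mem, wderiv_smul _ v2, u2, w2, σ2]
  have hU : U ∈ P.domA := by
    refine ⟨triple_mem q, hηm, ⟨U.u_mem, ?_⟩, ⟨add_mem (Submodule.smul_mem _ _ U.v_mem)
      (Submodule.smul_mem _ _ v2), ?_⟩, ⟨U.w_mem, ?_⟩, ?_, ?_, ?_, ?_⟩
    · rw [u1, ρ1]; exact Submodule.smul_mem _ _ hσm1
    · rw [x2]; exact hσm2
    · rw [u3, ρ3]; exact Submodule.smul_mem _ _ hσm3
    · rw [x2, u1, ρ1, trace_smul l1 _ hσm1 (right_mem_Icc.2 l1.le), t1, t2,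
        mul_inv_cancel_left₀ (nz k1)]
    · rw [x2, u3, ρ3, trace_smul l3 _ hσm3 (left_mem_Icc.2 l3.le), t3, t4,
        mul_inv_cancel_left₀ (nz k3)]
    · change trace (wderiv U.w) P.L = - P.δ₃ * trace η 0 - P.δ₂ * trace η 1
      have hk3 := nz k3
      rw [u3, ρ3, trace_smul l3 _ hσm3 (right_mem_Icc.2 l3.le), t5, hη0, hη1, hC]
      field_simp
      ring
    · change trace (restr P.Ioo_subset₃ (prim q)) P.L = trace η 0
      rw [trace_restr_prim l3 _ q (right_mem_Icc.2 l3.le), hpL, hη0]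
  have hs' : ∀ {a b : ℝ} (hab : Ioo a b ⊆ Ioo 0 P.L),
      restr hab s = (r : ℂ) • restr hab (prim q) - restr hab g := fun hab => by
    rw [hs, restr_sub, restr_smul]
  have hq' : ∀ {a b : ℝ} (hab : Ioo a b ⊆ Ioo 0 P.L),
      restr hab q = (r : ℂ) • restr hab p - restr hab p₀ := fun hab => by
    rw [hq, restr_sub, restr_smul]
  -- The three displacement equations reduce to `q = r p - p₀`, the three velocity equations to `s =
  -- r prim q - g`, and the last one to the transport equation.
  refine ⟨⟨U, hU⟩, Energy.ext_wderiv ?_ ?_ ?_ ?_ ?_ ?_ ?_⟩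
  · change wderiv ((r : ℂ) • U.u - U.y) = _
    rw [wderiv_sub (Submodule.smul_mem _ _ U.u_mem) v1, wderiv_smul _ U.u_mem, u1, w1, hq', p1,
      sub_sub_cancel]
  · change wderiv ((r : ℂ) • U.v - U.z) = _
    rw [wderiv_sub (Submodule.smul_mem _ _ U.v_mem) v2, wderiv_smul _ U.v_mem, u2, w2, hq', p2,
      sub_sub_cancel]
  · change wderiv ((r : ℂ) • U.w - U.φ) = _
    rw [wderiv_sub (Submodule.smul_mem _ _ U.w_mem) v3, wderiv_smul _ U.w_mem, u3, w3, hq', p3,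
      sub_sub_cancel]
  · change (r : ℂ) • restr P.Ioo_subset₁ (prim q) - (P.κ₁ : ℂ) • wderiv (wderiv U.u) = _
    rw [u1, ρ1, wderiv_smul _ hσm1, d1.wderiv_eq, smul_inv_smul₀ (nz k1), hs', g1, sub_sub_cancel]
  · change (r : ℂ) • restr P.Ioo_subset₂ (prim q)
      - wderiv (wderiv ((P.κ₂ : ℂ) • U.v + (P.δ₁ : ℂ) • U.z)) = _
    rw [x2, d2.wderiv_eq, hs', g2, sub_sub_cancel]
  · change (r : ℂ) • restr P.Ioo_subset₃ (prim q) - (P.κ₃ : ℂ) • wderiv (wderiv U.w) = _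
    rw [u3, ρ3, wderiv_smul _ hσm3, d3.wderiv_eq, smul_inv_smul₀ (nz k3), hs', g3, sub_sub_cancel]
  · change (r : ℂ) • η - (-(P.τ : ℂ)⁻¹) • wderiv η = F.η
    rw [hηd, smul_sub, smul_smul, smul_smul, neg_mul, inv_mul_cancel₀ (nz ht), Complex.ofReal_mul,
      neg_mul, mul_comm (r : ℂ), inv_mul_cancel_left₀ (nz ht)]
    module

end System

end

end BoundaryDelay

open BoundaryDelay in
theorem proposition2p1 (P : System) (hP : P.HypH) :
    IsMDissipative P.opA ∧
    ∃ T : ℝ≥0 → P.Energy →L[ℂ] P.Energy,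
      IsContractionSemigroup T ∧ IsGenerator P.opA T ∧
      ∀ U₀ : P.Energy, ∃ U : C(ℝ≥0, P.Energy),
        (∀ t, U t = T t U₀) ∧
        IsWeakSolution P.opA U₀ U ∧
        (∀ V : C(ℝ≥0, P.Energy), IsWeakSolution P.opA U₀ V → V = U) ∧
        (U₀ ∈ P.opA.domain → IsStrongSolution P.opA U₀ U) := by
  have h : IsMDissipative P.opA :=
    ⟨System.isDissipative_opA hP, fun _ hr F => System.smul_sub_opA_surjective hP hr F⟩
  exact ⟨h, h.exists_contractionSemigroup⟩
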